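/- Let $K$ be a field of characteristic zero. Let $W$ be the Witt algebra, the Lie algebra with $K$-basis $\{e_n : n\in\mathbb Z\}$ and bracket $[e_i,e_j]=(j-i)e_{i+j}$; let $W_+$ and $\mathbf W_1$ be the Lie subalgebras of $W$ spanned by $\{e_n : n\ge 1\}$ and by $\{e_n : n\ge -1\}$, respectively. Let $\mathrm{Vir}$ be the Virasoro algebra, the Lie algebra with $K$-basis $\{e_n : n\in\mathbb Z\}\cup\{c\}$, where $c$ is central and $[e_i,e_j]=(j-i)e_{i+j}+\frac{i^3-i}{12}\,\delta_{i+j,0}\,c$. Write $U(\mathfrak g)$ for the universal enveloping algebra of a Lie algebra $\mathfrak g$. A ring $R$ is called Hopfian if it is not isomorphic to $R/J$ for any nonzero two-sided ideal $J$ of $R$, and Bassian if there is no injective ring homomorphism $R\to R/J$ for any nonzero two-sided ideal $J$ of $R$. Then the algebras $U(W_+)$, $U(W)$, $U(\mathbf W_1)$ and, for every $\kappa\in K$, $U(\mathrm{Vir})/(c-\kappa)$ are Bassian and Hopfian, and $U(\mathrm{Vir})$ is Hopfian. -/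

import Mathlib

noncomputable section

/-! ### The Witt algebra -/

/-- The Witt algebra `W` over `K`: the `K`-vector space with basis `e n`, `n : ℤ`
(see `Witt.e`), and bracket `⁅e i, e j⁆ = (j - i) e (i + j)` (see `Witt.lie_e_e`). -/
def Witt (K : Type*) [Field K] : Type _ := ℤ →₀ K

namespace Witt

instance (K : Type*) [Field K] : AddCommGroup (Witt K) := inferInstanceAs (AddCommGroup (ℤ →₀ K))
instance (K : Type*) [Field K] : Module K (Witt K) := inferInstanceAs (Module K (ℤ →₀ K))

/-- The basis `e n`, `n : ℤ`. -/
def basis (K : Type*) [Field K] : Module.Basis ℤ K (Witt K) := ⟨LinearEquiv.refl K (ℤ →₀ K)⟩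

/-- The basis vector `e n`. -/
def e (K : Type*) [Field K] (n : ℤ) : Witt K := basis K n

/-- The bilinear map with `(e i, e j) ↦ (j - i) e (i + j)`. -/
def bracket (K : Type*) [Field K] : Witt K →ₗ[K] Witt K →ₗ[K] Witt K :=
  (basis K).constr K fun i => (basis K).constr K fun j => ((j - i : ℤ) : K) • e K (i + j)

theorem bracket_e_e (K : Type*) [Field K] (i j : ℤ) :
    bracket K (e K i) (e K j) = ((j - i : ℤ) : K) • e K (i + j) := by
  simp [bracket, e]

theorem induction {K : Type*} [Field K] {p : Witt K → Prop} (x : Witt K)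
    (add : ∀ x y, p x → p y → p (x + y)) (smul : ∀ (a : K) x, p x → p (a • x))
    (he : ∀ n, p (e K n)) : p x := by
  have hx : x ∈ Submodule.span K (Set.range (basis K)) := by
    rw [(basis K).span_eq]; trivial
  induction hx using Submodule.span_induction with
  | mem x h => obtain ⟨n, rfl⟩ := h; exact he n
  | zero => simpa using smul 0 _ (he 0)
  | add x y _ _ hx hy => exact add x y hx hy
  | smul a x _ hx => exact smul a x hx

theorem bracket_skew {K : Type*} [Field K] (x y : Witt K) :
    bracket K x y = - bracket K y x := by
  induction x using induction with
  | add x x' hx hx' => simp only [map_add, LinearMap.add_apply, hx, hx']; abel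
  | smul a x hx => simp [hx]
  | he i =>
    induction y using induction with
    | add y y' hy hy' => simp only [map_add, LinearMap.add_apply, hy, hy']; abel
    | smul a y hy => simp [hy]
    | he j =>
      rw [bracket_e_e, bracket_e_e, add_comm j i, ← neg_smul]
      congr 1; push_cast; ring

theorem bracket_self {K : Type*} [Field K] (x : Witt K) : bracket K x x = 0 := by
  induction x using induction with
  | add x y hx hy =>
    simp only [map_add, LinearMap.add_apply, hx, hy]
    rw [bracket_skew x y]; abel
  | smul a x hx => simp [hx]
  | he i => simp [bracket_e_e]

theorem bracket_leibniz {K : Type*} [Field K] (x y z : Witt K) :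
    bracket K x (bracket K y z) =
      bracket K (bracket K x y) z + bracket K y (bracket K x z) := by
  induction x using induction with
  | add x x' hx hx' => simp only [map_add, LinearMap.add_apply, hx, hx']; abel
  | smul a x hx => simp [hx]
  | he i =>
    induction y using induction with
    | add y y' hy hy' => simp only [map_add, LinearMap.add_apply, hy, hy']; abel
    | smul a y hy => simp [hy]
    | he j =>
      induction z using induction with
      | add z z' hz hz' => simp only [map_add, hz, hz']; abel
      | smul a z hz => simp [hz]
      | he k =>
        simp only [bracket_e_e, map_smul, LinearMap.smul_apply, smul_smul]
        rw [← add_assoc i j k, add_left_comm j i k, ← add_assoc i j k, ← add_smul]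
        congr 1; push_cast; ring

instance (K : Type*) [Field K] : LieRing (Witt K) where
  bracket x y := bracket K x y
  add_lie x y z := by simp
  lie_add x y z := by simp
  lie_self x := bracket_self x
  leibniz_lie x y z := bracket_leibniz x y z

instance (K : Type*) [Field K] : LieAlgebra K (Witt K) where
  lie_smul a x y := map_smul (bracket K x) a y

theorem lie_e_e (K : Type*) [Field K] (i j : ℤ) :
    ⁅e K i, e K j⁆ = ((j - i : ℤ) : K) • e K (i + j) := bracket_e_e K i j

theorem lie_mem_span {K : Type*} [Field K] {S : Set ℤ}
    (hS : ∀ i ∈ S, ∀ j ∈ S, i ≠ j → i + j ∈ S) {x y : Witt K}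
    (hx : x ∈ Submodule.span K (e K '' S)) (hy : y ∈ Submodule.span K (e K '' S)) :
    ⁅x, y⁆ ∈ Submodule.span K (e K '' S) := by
  induction hx using Submodule.span_induction with
  | zero => simp
  | add x x' _ _ hx hx' => rw [add_lie]; exact add_mem hx hx'
  | smul a x _ hx => rw [smul_lie]; exact Submodule.smul_mem _ a hx
  | mem x hx =>
    obtain ⟨i, hi, rfl⟩ := hx
    induction hy using Submodule.span_induction with
    | zero => simp
    | add y y' _ _ hy hy' => rw [lie_add]; exact add_mem hy hy'
    | smul a y _ hy => rw [lie_smul]; exact Submodule.smul_mem _ a hy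
    | mem y hy =>
      obtain ⟨j, hj, rfl⟩ := hy
      rw [lie_e_e]
      rcases eq_or_ne i j with rfl | hij
      · simp
      · exact Submodule.smul_mem _ _ (Submodule.subset_span ⟨i + j, hS i hi j hj hij, rfl⟩)

end Witt

/-- The positive Witt algebra `W_+`: the Lie subalgebra of `W` spanned by the `e n`, `n ≥ 1`. -/
def wittPos (K : Type*) [Field K] : LieSubalgebra K (Witt K) where
  __ := Submodule.span K (Witt.e K '' {n : ℤ | 1 ≤ n})
  lie_mem' := fun hx hy => Witt.lie_mem_span
    (fun i (hi : 1 ≤ i) j (hj : 1 ≤ j) _ => show 1 ≤ i + j by omega) hx hy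

/-- The first Cartan algebra `𝐖₁`: the Lie subalgebra of `W` spanned by the `e n`, `n ≥ -1`. -/
def cartanW1 (K : Type*) [Field K] : LieSubalgebra K (Witt K) where
  __ := Submodule.span K (Witt.e K '' {n : ℤ | -1 ≤ n})
  lie_mem' := fun hx hy => Witt.lie_mem_span
    (fun i (hi : -1 ≤ i) j (hj : -1 ≤ j) _ => show -1 ≤ i + j by omega) hx hy

/-! ### The Virasoro algebra -/

/-- The Virasoro algebra over `K`: the `K`-vector space with basis `e n`, `n : ℤ`, and `c`
(see `Virasoro.e`, `Virasoro.c`), with `c` central and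
`⁅e i, e j⁆ = (j - i) e (i + j) + (i ^ 3 - i) / 12 δ_{i + j, 0} c`
(see `Virasoro.lie_e_e`, `Virasoro.lie_c`). -/
@[ext] structure Virasoro (K : Type*) [Field K] where
  /-- The component in the span of the `e n`. -/
  witt : Witt K
  /-- The coefficient of `c`. -/
  central : K

namespace Virasoro

/-- The underlying vector space is `W × K`. -/
def equivProd (K : Type*) [Field K] : Virasoro K ≃ Witt K × K where
  toFun x := (x.witt, x.central)
  invFun x := ⟨x.1, x.2⟩
  left_inv _ := rfl
  right_inv _ := rfl

instance (K : Type*) [Field K] : AddCommGroup (Virasoro K) := (equivProd K).addCommGroup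
instance (K : Type*) [Field K] : Module K (Virasoro K) := (equivProd K).module K

/-- The basis vector `e n`. -/
def e (K : Type*) [Field K] (n : ℤ) : Virasoro K := ⟨Witt.e K n, 0⟩

/-- The central basis vector `c`. -/
def c (K : Type*) [Field K] : Virasoro K := ⟨0, 1⟩

@[simp] theorem witt_add {K : Type*} [Field K] (x y : Virasoro K) :
    (x + y).witt = x.witt + y.witt := rfl
@[simp] theorem central_add {K : Type*} [Field K] (x y : Virasoro K) :
    (x + y).central = x.central + y.central := rfl
@[simp] theorem witt_zero {K : Type*} [Field K] : (0 : Virasoro K).witt = 0 := rfl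
@[simp] theorem central_zero {K : Type*} [Field K] : (0 : Virasoro K).central = 0 := rfl
@[simp] theorem witt_smul {K : Type*} [Field K] (a : K) (x : Virasoro K) :
    (a • x).witt = a • x.witt := rfl
@[simp] theorem central_smul {K : Type*} [Field K] (a : K) (x : Virasoro K) :
    (a • x).central = a * x.central := rfl

/-- The bilinear form on `W` with `(e i, e j) ↦ (i ^ 3 - i) / 12 δ_{i + j, 0}`. -/
def cocycle (K : Type*) [Field K] : Witt K →ₗ[K] Witt K →ₗ[K] K :=
  (Witt.basis K).constr K fun i => (Witt.basis K).constr K fun j =>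
    if i + j = 0 then ((i : K) ^ 3 - (i : K)) / 12 else 0

theorem cocycle_e_e (K : Type*) [Field K] (i j : ℤ) :
    cocycle K (Witt.e K i) (Witt.e K j) =
      if i + j = 0 then ((i : K) ^ 3 - (i : K)) / 12 else 0 := by
  simp [cocycle, Witt.e]

theorem cocycle_skew {K : Type*} [Field K] (x y : Witt K) :
    cocycle K x y = - cocycle K y x := by
  induction x using Witt.induction with
  | add x x' hx hx' => simp only [map_add, LinearMap.add_apply, hx, hx']; abel
  | smul a x hx => simp [hx]
  | he i =>
    induction y using Witt.induction with
    | add y y' hy hy' => simp only [map_add, LinearMap.add_apply, hy, hy']; abel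
    | smul a y hy => simp [hy]
    | he j =>
      rw [cocycle_e_e, cocycle_e_e, add_comm j i]
      split_ifs with h
      · obtain rfl : j = -i := by omega
        push_cast; ring
      · simp

theorem cocycle_self {K : Type*} [Field K] (x : Witt K) : cocycle K x x = 0 := by
  induction x using Witt.induction with
  | add x y hx hy =>
    simp only [map_add, LinearMap.add_apply, hx, hy]
    rw [cocycle_skew x y]; abel
  | smul a x hx => simp [hx]
  | he i =>
    rw [cocycle_e_e]
    split_ifs with h
    · obtain rfl : i = 0 := by omega
      simp
    · rfl

theorem cocycle_leibniz {K : Type*} [Field K] (x y z : Witt K) :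
    cocycle K x ⁅y, z⁆ = cocycle K ⁅x, y⁆ z + cocycle K y ⁅x, z⁆ := by
  induction x using Witt.induction with
  | add x x' hx hx' =>
    simp only [map_add, LinearMap.add_apply, add_lie, hx, hx']; abel
  | smul a x hx => simp [hx, mul_add]
  | he i =>
    induction y using Witt.induction with
    | add y y' hy hy' =>
      simp only [map_add, LinearMap.add_apply, add_lie, lie_add, hy, hy']; abel
    | smul a y hy => simp [hy, mul_add]
    | he j =>
      induction z using Witt.induction with
      | add z z' hz hz' => simp only [map_add, lie_add, hz, hz']; abel
      | smul a z hz => simp [hz, mul_add]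
      | he k =>
        simp only [Witt.lie_e_e, map_smul, LinearMap.smul_apply, cocycle_e_e, smul_eq_mul]
        rw [← add_assoc i j k, add_left_comm j i k, ← add_assoc i j k]
        split_ifs with h
        · obtain rfl : k = -i - j := by omega
          push_cast; ring
        · simp

instance (K : Type*) [Field K] : LieRing (Virasoro K) where
  bracket x y := ⟨⁅x.witt, y.witt⁆, cocycle K x.witt y.witt⟩
  add_lie x y z := by ext1 <;> simp [Bracket.bracket]
  lie_add x y z := by ext1 <;> simp [Bracket.bracket]
  lie_self x := by
    ext1
    · exact lie_self x.witt
    · exact cocycle_self x.witt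
  leibniz_lie x y z := by
    ext1
    · exact leibniz_lie x.witt y.witt z.witt
    · exact cocycle_leibniz x.witt y.witt z.witt

instance (K : Type*) [Field K] : LieAlgebra K (Virasoro K) where
  lie_smul a x y := by
    ext1
    · exact lie_smul a x.witt y.witt
    · exact map_smul (cocycle K x.witt) a y.witt

theorem lie_e_e (K : Type*) [Field K] (i j : ℤ) :
    ⁅e K i, e K j⁆ = ((j - i : ℤ) : K) • e K (i + j) +
      (if i + j = 0 then ((i : K) ^ 3 - (i : K)) / 12 else 0) • c K := by
  ext1
  · rw [witt_add, witt_smul, witt_smul, show (c K).witt = 0 from rfl, smul_zero, add_zero]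
    exact Witt.lie_e_e K i j
  · rw [central_add, central_smul, central_smul, show (c K).central = 1 from rfl,
      show (e K (i + j)).central = 0 from rfl, mul_zero, zero_add, mul_one]
    exact cocycle_e_e K i j

theorem lie_c (K : Type*) [Field K] (x : Virasoro K) : ⁅x, c K⁆ = 0 := by
  ext1
  · exact lie_zero x.witt
  · exact map_zero (cocycle K x.witt)

/-- The two-sided ideal `(c - κ)` of `U(Vir)`. -/
def centralIdeal (K : Type*) [Field K] (κ : K) :
    TwoSidedIdeal (UniversalEnvelopingAlgebra K (Virasoro K)) :=
  TwoSidedIdeal.span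
    {UniversalEnvelopingAlgebra.ι K (c K) -
      algebraMap K (UniversalEnvelopingAlgebra K (Virasoro K)) κ}

/-- The central quotient `U(Vir) / (c - κ)`. -/
abbrev CentralQuotient (K : Type*) [Field K] (κ : K) : Type _ :=
  (centralIdeal K κ).ringCon.Quotient

end Virasoro

end

/-! ### Hopfian and Bassian rings -/

/-- `R` is Hopfian if it is not isomorphic, as a ring, to any proper quotient `R / J`, that is, to
a quotient by a nonzero two-sided ideal `J`. -/
def IsHopfianRing (R : Type*) [Ring R] : Prop :=
  ∀ J : TwoSidedIdeal R, J ≠ ⊥ → IsEmpty (R ≃+* J.ringCon.Quotient)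

/-- `R` is Bassian if there is no injective ring homomorphism from `R` into a proper quotient
`R / J`, that is, into a quotient by a nonzero two-sided ideal `J`. -/
def IsBassianRing (R : Type*) [Ring R] : Prop :=
  ∀ J : TwoSidedIdeal R, J ≠ ⊥ → ∀ f : R →+* J.ringCon.Quotient, ¬ Function.Injective f

noncomputable section

/-! ### Words in the generators of an algebra and the filtration by their weight -/

namespace WeightedWords

open Submodule

variable {C R ι : Type*} [CommRing C] [Ring R] [Algebra C R]

/-- The product of the generators listed in `l`. -/
def word (e : ι → R) (l : List ι) : R := (l.map e).prod

/-- The weight of a word. -/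
def wt (w : ι → ℕ) (l : List ι) : ℕ := (l.map w).sum

@[simp] theorem word_nil (e : ι → R) : word e [] = 1 := rfl
@[simp] theorem word_cons (e : ι → R) (i : ι) (l : List ι) :
    word e (i :: l) = e i * word e l := by simp [word]
theorem word_append (e : ι → R) (l l' : List ι) : word e (l ++ l') = word e l * word e l' := by
  simp [word]
@[simp] theorem wt_nil (w : ι → ℕ) : wt w [] = 0 := rfl
@[simp] theorem wt_cons (w : ι → ℕ) (i : ι) (l : List ι) : wt w (i :: l) = w i + wt w l := by
  simp [wt]
theorem wt_append (w : ι → ℕ) (l l' : List ι) : wt w (l ++ l') = wt w l + wt w l' := by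
  simp [wt]
theorem wt_perm (w : ι → ℕ) {l l' : List ι} (h : l.Perm l') : wt w l = wt w l' :=
  (h.map w).sum_eq

variable (C) in
/-- The span of the words of weight less than `s`. -/
def Fil (e : ι → R) (w : ι → ℕ) (s : ℕ) : Submodule C R :=
  span C {x | ∃ l, wt w l < s ∧ word e l = x}

variable {e : ι → R} {w : ι → ℕ}

theorem word_mem_Fil {l : List ι} {s : ℕ} (h : wt w l < s) : word e l ∈ Fil C e w s :=
  subset_span ⟨l, h, rfl⟩

theorem Fil_mono {s t : ℕ} (h : s ≤ t) : Fil C e w s ≤ Fil C e w t :=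
  span_mono fun _ ⟨l, hl, hx⟩ => ⟨l, hl.trans_le h, hx⟩

theorem Fil_le {s : ℕ} {N : Submodule C R} (h : ∀ l, wt w l < s → word e l ∈ N) :
    Fil C e w s ≤ N :=
  span_le.2 fun _ ⟨l, hl, hx⟩ => hx ▸ h l hl

@[simp] theorem Fil_zero : Fil C e w 0 = ⊥ := by
  simp [Fil]

theorem mul_mem_Fil {a b : ℕ} {x y : R} (hx : x ∈ Fil C e w (a + 1)) (hy : y ∈ Fil C e w b) :
    x * y ∈ Fil C e w (a + b) := by
  have h := Submodule.mul_mem_mul hx hy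
  rw [Fil, Fil, span_mul_span] at h
  refine (span_le.2 ?_ : _ ≤ Fil C e w (a + b)) h
  rintro _ ⟨_, ⟨l, hl, rfl⟩, _, ⟨l', hl', rfl⟩, rfl⟩
  change word e l * word e l' ∈ _
  rw [← word_append]
  exact word_mem_Fil (by rw [wt_append]; omega)

theorem mul_mem_Fil' {a b : ℕ} {x y : R} (hx : x ∈ Fil C e w a) (hy : y ∈ Fil C e w (b + 1)) :
    x * y ∈ Fil C e w (a + b) := by
  have h := Submodule.mul_mem_mul hx hy
  rw [Fil, Fil, span_mul_span] at h
  refine (span_le.2 ?_ : _ ≤ Fil C e w (a + b)) h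
  rintro _ ⟨_, ⟨l, hl, rfl⟩, _, ⟨l', hl', rfl⟩, rfl⟩
  change word e l * word e l' ∈ _
  rw [← word_append]
  exact word_mem_Fil (by rw [wt_append]; omega)

theorem word_mul_mem_Fil (l : List ι) {b : ℕ} {y : R} (hy : y ∈ Fil C e w b) :
    word e l * y ∈ Fil C e w (wt w l + b) :=
  mul_mem_Fil (word_mem_Fil (Nat.lt_succ_self _)) hy

theorem mul_word_mem_Fil (l : List ι) {b : ℕ} {y : R} (hy : y ∈ Fil C e w b) :
    y * word e l ∈ Fil C e w (b + wt w l) :=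
  mul_mem_Fil' hy (word_mem_Fil (Nat.lt_succ_self _))

variable (C) in
/-- The commutators of the generators have less than the expected weight. -/
def CommLower (e : ι → R) (w : ι → ℕ) : Prop :=
  ∀ i j, e i * e j - e j * e i ∈ Fil C e w (w i + w j)

theorem CommLower.word_sub_word (hc : CommLower C e w) {l l' : List ι} (h : l.Perm l') :
    word e l - word e l' ∈ Fil C e w (wt w l) := by
  induction h with
  | nil => simp
  | cons i h ih =>
    rw [word_cons, word_cons, ← mul_sub, wt_cons]
    have := word_mul_mem_Fil [i] ih
    simpa using this
  | swap i j l =>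
    have := mul_word_mem_Fil l (hc j i)
    simp only [word_cons, wt_cons, ← mul_assoc, ← sub_mul, ← add_assoc]
    exact this
  | trans h h' ih ih' =>
    rw [← wt_perm w h] at ih'
    simpa using add_mem ih ih'

/-- The monomial `m` in the generators, with the factors in some order. -/
def mon (e : ι → R) (m : ι →₀ ℕ) : R := word e (Finsupp.toMultiset m).toList

/-- The weight of a monomial. -/
def mwt (w : ι → ℕ) (m : ι →₀ ℕ) : ℕ := ((Finsupp.toMultiset m).map w).sum

theorem wt_eq_mwt (w : ι → ℕ) {l : List ι} {m : ι →₀ ℕ}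
    (h : (l : Multiset ι) = Finsupp.toMultiset m) : wt w l = mwt w m := by
  rw [mwt, ← h]; simp [wt]

theorem wt_toList (w : ι → ℕ) (m : ι →₀ ℕ) : wt w (Finsupp.toMultiset m).toList = mwt w m :=
  wt_eq_mwt w (by simp)

theorem mwt_add (w : ι → ℕ) (m m' : ι →₀ ℕ) : mwt w (m + m') = mwt w m + mwt w m' := by
  simp [mwt]

@[simp] theorem mwt_zero (w : ι → ℕ) : mwt w 0 = 0 := by simp [mwt]

@[simp] theorem mwt_single (w : ι → ℕ) (i : ι) (n : ℕ) :
    mwt w (Finsupp.single i n) = n * w i := by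
  simp [mwt, Finsupp.toMultiset_single, Multiset.map_nsmul, Multiset.sum_nsmul]

theorem mon_mem_Fil {m : ι →₀ ℕ} {s : ℕ} (h : mwt w m < s) : mon e m ∈ Fil C e w s :=
  word_mem_Fil (by rwa [wt_toList])

@[simp] theorem mon_zero (e : ι → R) : mon e 0 = 1 := by simp [mon]

theorem CommLower.word_sub_mon (hc : CommLower C e w) {l : List ι} {m : ι →₀ ℕ}
    (h : (l : Multiset ι) = Finsupp.toMultiset m) :
    word e l - mon e m ∈ Fil C e w (mwt w m) := by
  rw [← wt_eq_mwt w h]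
  refine hc.word_sub_word ?_
  rw [← Multiset.coe_eq_coe, h, Multiset.coe_toList]

theorem CommLower.mon_mul_mon (hc : CommLower C e w) (m m' : ι →₀ ℕ) :
    mon e m * mon e m' - mon e (m + m') ∈ Fil C e w (mwt w (m + m')) := by
  rw [mon, mon, ← word_append]
  exact hc.word_sub_mon (by rw [← Multiset.coe_add]; simp)

theorem exists_toMultiset (l : List ι) : ∃ m : ι →₀ ℕ, (l : Multiset ι) = Finsupp.toMultiset m := by
  classical
  exact ⟨Multiset.toFinsupp l, by simp⟩

theorem CommLower.Fil_le_span (hc : CommLower C e w) (s : ℕ) :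
    Fil C e w s ≤ span C {x | ∃ m, mwt w m < s ∧ mon e m = x} := by
  induction s with
  | zero => simp
  | succ s ih =>
    refine Fil_le fun l hl => ?_
    obtain ⟨m, hm⟩ := exists_toMultiset l
    have h1 := hc.word_sub_mon hm
    have h2 := wt_eq_mwt w hm
    have h3 : span C {x | ∃ m, mwt w m < s ∧ mon e m = x} ≤
      span C {x | ∃ m, mwt w m < s + 1 ∧ mon e m = x} :=
      span_mono fun x ⟨m, hm, hx⟩ => ⟨m, hm.trans (Nat.lt_succ_self s), hx⟩
    have h4 := h3 (ih (Fil_mono (by omega) h1))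
    have h5 : mon e m ∈ span C {x | ∃ m, mwt w m < s + 1 ∧ mon e m = x} :=
      subset_span ⟨m, by omega, rfl⟩
    simpa using add_mem h4 h5

theorem exists_mem_Fil (hgen : Algebra.adjoin C (Set.range e) = ⊤) (x : R) :
    ∃ s, x ∈ Fil C e w s := by
  have hx : x ∈ Algebra.adjoin C (Set.range e) := by rw [hgen]; trivial
  induction hx using Algebra.adjoin_induction with
  | mem x hx =>
    obtain ⟨i, rfl⟩ := hx
    refine ⟨w i + 1, ?_⟩
    have : word e [i] ∈ Fil C e w (w i + 1) := word_mem_Fil (by simp)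
    simpa using this
  | algebraMap r =>
    refine ⟨1, ?_⟩
    have : word e [] ∈ Fil C e w 1 := word_mem_Fil (by simp)
    rw [Algebra.algebraMap_eq_smul_one]
    exact Submodule.smul_mem _ _ this
  | add x y _ _ hx hy =>
    obtain ⟨s, hs⟩ := hx
    obtain ⟨t, ht⟩ := hy
    exact ⟨s + t, add_mem (Fil_mono (by omega) hs) (Fil_mono (by omega) ht)⟩
  | mul x y _ _ hx hy =>
    obtain ⟨s, hs⟩ := hx
    obtain ⟨t, ht⟩ := hy
    exact ⟨s + t, mul_mem_Fil (Fil_mono (by omega) hs) ht⟩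

variable (C) in
/-- The linear map from the polynomial ring that sends each monomial to `mon e`. -/
def quant (e : ι → R) : MvPolynomial ι C →ₗ[C] R :=
  (MvPolynomial.basisMonomials ι C).constr C (mon e)

@[simp] theorem quant_monomial (m : ι →₀ ℕ) (c : C) :
    quant C e (MvPolynomial.monomial m c) = c • mon e m := by
  have h : quant C e (MvPolynomial.monomial m 1) = mon e m := by
    have := (MvPolynomial.basisMonomials ι C).constr_basis C (mon e) m
    rwa [MvPolynomial.coe_basisMonomials] at this
  rw [← h, ← map_smul, MvPolynomial.smul_monomial, smul_eq_mul, mul_one]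

theorem quant_C (c : C) : quant C e (MvPolynomial.C c) = algebraMap C R c := by
  rw [MvPolynomial.C_apply, quant_monomial, mon_zero, Algebra.algebraMap_eq_smul_one]

theorem quant_eq_sum (P : MvPolynomial ι C) :
    quant C e P = ∑ m ∈ P.support, MvPolynomial.coeff m P • mon e m := by
  have h := congrArg (quant C e) P.as_sum
  rw [map_sum] at h
  exact h.trans (Finset.sum_congr rfl fun m _ => quant_monomial m _)

theorem CommLower.Fil_le_map (hc : CommLower C e w) (s : ℕ) {x : R} (hx : x ∈ Fil C e w s) :
    ∃ P : MvPolynomial ι C, (∀ m ∈ P.support, mwt w m < s) ∧ quant C e P = x := by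
  have h := hc.Fil_le_span s hx
  clear hx
  induction h using span_induction with
  | mem x h =>
    obtain ⟨m, hm, rfl⟩ := h
    refine ⟨MvPolynomial.monomial m 1, fun m' hm' => ?_, by simp⟩
    have := MvPolynomial.support_monomial_subset hm'
    simp only [Finset.mem_singleton] at this
    exact this ▸ hm
  | zero => exact ⟨0, by simp, by simp⟩
  | add x y _ _ hx hy =>
    classical
    obtain ⟨P, hP, rfl⟩ := hx
    obtain ⟨Q, hQ, rfl⟩ := hy
    refine ⟨P + Q, fun m hm => ?_, by simp⟩
    rcases Finset.mem_union.1 (MvPolynomial.support_add hm) with h | h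
    exacts [hP m h, hQ m h]
  | smul c x _ hx =>
    obtain ⟨P, hP, rfl⟩ := hx
    exact ⟨c • P, fun m hm => hP m (MvPolynomial.support_smul hm), by simp⟩

end WeightedWords

/-! ### Symbols for the filtration by degree -/

namespace WeightedWords

open Submodule MvPolynomial

variable {C R ι : Type*} [CommRing C] [Ring R] [Algebra C R] {e : ι → R}

theorem mwt_one (m : ι →₀ ℕ) : mwt (fun _ => 1) m = m.degree := by
  induction m using Finsupp.induction_linear with
  | zero => simp
  | add f g hf hg => rw [mwt_add, hf, hg, map_add]
  | single i n => simp

theorem wt_one (l : List ι) : wt (fun _ => 1) l = l.length := by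
  simp [wt]

variable (C) in
/-- The subspace of the elements of degree less than `d`. -/
abbrev DegFil (e : ι → R) (d : ℕ) : Submodule C R := Fil C e (fun _ => 1) d

variable (C) in
/-- `P` is the symbol in degree `d` of the element `x` of degree at most `d`. -/
def IsSymbol (e : ι → R) (d : ℕ) (x : R) (P : MvPolynomial ι C) : Prop :=
  P.IsHomogeneous d ∧ x - quant C e P ∈ DegFil C e d

theorem quant_mem_Fil {w : ι → ℕ} {P : MvPolynomial ι C} {s : ℕ}
    (h : ∀ m ∈ P.support, mwt w m < s) : quant C e P ∈ Fil C e w s := by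
  rw [quant_eq_sum]
  exact sum_mem fun m hm => smul_mem _ _ (mon_mem_Fil (h m hm))

theorem degree_of_mem_support {P : MvPolynomial ι C} {d : ℕ} (hP : P.IsHomogeneous d)
    {m : ι →₀ ℕ} (hm : m ∈ P.support) : m.degree = d := by
  by_contra h
  exact MvPolynomial.mem_support_iff.1 hm (hP.coeff_eq_zero h)

theorem quant_mem_DegFil {P : MvPolynomial ι C} {d : ℕ} (hP : P.IsHomogeneous d) :
    quant C e P ∈ DegFil C e (d + 1) :=
  quant_mem_Fil fun m hm => by rw [mwt_one, degree_of_mem_support hP hm]; omega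

theorem IsSymbol.mem {d : ℕ} {x : R} {P : MvPolynomial ι C} (h : IsSymbol C e d x P) :
    x ∈ DegFil C e (d + 1) := by
  simpa using add_mem (Fil_mono (Nat.le_succ d) h.2) (quant_mem_DegFil (e := e) h.1)

theorem IsSymbol.zero_of_mem {d : ℕ} {x : R} (h : x ∈ DegFil C e d) :
    IsSymbol C e d x (0 : MvPolynomial ι C) :=
  ⟨isHomogeneous_zero _ _ _, by simpa using h⟩

theorem IsSymbol.add {d : ℕ} {x y : R} {P Q : MvPolynomial ι C} (hx : IsSymbol C e d x P)
    (hy : IsSymbol C e d y Q) : IsSymbol C e d (x + y) (P + Q) :=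
  ⟨hx.1.add hy.1, by rw [map_add, add_sub_add_comm]; exact add_mem hx.2 hy.2⟩

theorem IsSymbol.sub {d : ℕ} {x y : R} {P Q : MvPolynomial ι C} (hx : IsSymbol C e d x P)
    (hy : IsSymbol C e d y Q) : IsSymbol C e d (x - y) (P - Q) :=
  ⟨hx.1.sub hy.1, by rw [map_sub, sub_sub_sub_comm]; exact sub_mem hx.2 hy.2⟩

theorem IsSymbol.smul {d : ℕ} {x : R} {P : MvPolynomial ι C} (c : C) (hx : IsSymbol C e d x P) :
    IsSymbol C e d (c • x) (c • P) :=
  ⟨(homogeneousSubmodule ι C d).smul_mem c hx.1, by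
    rw [map_smul, ← smul_sub]; exact smul_mem _ _ hx.2⟩

theorem IsSymbol.sum {κ : Type*} (s : Finset κ) {d : ℕ} {x : κ → R} {P : κ → MvPolynomial ι C}
    (h : ∀ i ∈ s, IsSymbol C e d (x i) (P i)) : IsSymbol C e d (∑ i ∈ s, x i) (∑ i ∈ s, P i) := by
  classical
  induction s using Finset.induction_on with
  | empty => simpa using IsSymbol.zero_of_mem (C := C) (e := e) (zero_mem (DegFil C e d))
  | insert a s ha ih =>
    rw [Finset.sum_insert ha, Finset.sum_insert ha]
    exact (h a (by simp)).add (ih fun i hi => h i (by simp [hi]))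

theorem quant_mul_quant (hc : CommLower C e fun _ => 1) {P Q : MvPolynomial ι C} {a b : ℕ}
    (hP : P.IsHomogeneous a) (hQ : Q.IsHomogeneous b) :
    quant C e P * quant C e Q - quant C e (P * Q) ∈ DegFil C e (a + b) := by
  have h : quant C e (P * Q) = ∑ m ∈ P.support, ∑ m' ∈ Q.support,
      (coeff m P * coeff m' Q) • mon e (m + m') := by
    conv_lhs => rw [P.as_sum, Q.as_sum, Finset.sum_mul_sum]
    simp [monomial_mul]
  rw [h, quant_eq_sum P, quant_eq_sum Q, Finset.sum_mul_sum, ← Finset.sum_sub_distrib]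
  refine sum_mem fun m hm => ?_
  rw [← Finset.sum_sub_distrib]
  refine sum_mem fun m' hm' => ?_
  rw [smul_mul_smul_comm, ← smul_sub]
  have := hc.mon_mul_mon m m'
  rw [mwt_one, map_add, degree_of_mem_support hP hm, degree_of_mem_support hQ hm'] at this
  exact smul_mem _ _ this

theorem IsSymbol.mul (hc : CommLower C e fun _ => 1) {a b : ℕ} {x y : R} {P Q : MvPolynomial ι C}
    (hx : IsSymbol C e a x P) (hy : IsSymbol C e b y Q) :
    IsSymbol C e (a + b) (x * y) (P * Q) := by
  refine ⟨hx.1.mul hy.1, ?_⟩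
  have h1 := mul_mem_Fil' hx.2 hy.mem
  have h2 := mul_mem_Fil (quant_mem_DegFil (e := e) hx.1) hy.2
  have h3 := quant_mul_quant (e := e) hc hx.1 hy.1
  convert add_mem (add_mem h1 h2) h3 using 1
  noncomm_ring

theorem prod_map_X {l : List ι} {m : ι →₀ ℕ} (h : (l : Multiset ι) = Finsupp.toMultiset m) :
    (l.map (X : ι → MvPolynomial ι C)).prod = monomial m 1 := by
  classical
  obtain rfl : m = Multiset.toFinsupp (l : Multiset ι) := by rw [h]; simp
  clear h
  induction l with
  | nil => simp
  | cons i l ih =>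
    rw [List.map_cons, List.prod_cons, ih, ← Multiset.cons_coe, ← Multiset.singleton_add,
      Multiset.toFinsupp_add, Multiset.toFinsupp_singleton, X, monomial_mul, one_mul]

theorem isHomogeneous_prod_map_X (l : List ι) :
    ((l.map (X : ι → MvPolynomial ι C)).prod).IsHomogeneous l.length := by
  induction l with
  | nil => simpa using isHomogeneous_one ι C
  | cons i l ih =>
    rw [List.map_cons, List.prod_cons, List.length_cons, add_comm]
    exact (isHomogeneous_X C i).mul ih

theorem isSymbol_word (hc : CommLower C e fun _ => 1) (l : List ι) :
    IsSymbol C e l.length (word e l) (l.map X).prod := by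
  refine ⟨isHomogeneous_prod_map_X l, ?_⟩
  obtain ⟨m, hm⟩ := exists_toMultiset l
  rw [prod_map_X hm, quant_monomial, one_smul]
  have := hc.word_sub_mon hm
  rwa [← wt_eq_mwt _ hm, wt_one] at this

/-- A linear map that is compatible with a linear map of symbols on words is so in general. -/
theorem IsSymbol.map (f : R →ₗ[C] R) (D : MvPolynomial ι C →ₗ[C] MvPolynomial ι C) {r : ℕ → ℕ}
    (hf : ∀ l : List ι, IsSymbol C e (r l.length) (f (word e l)) (D (l.map X).prod))
    (hlow : ∀ d, ∀ x ∈ DegFil C e d, f x ∈ DegFil C e (r d))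
    {d : ℕ} {x : R} {P : MvPolynomial ι C} (hx : IsSymbol C e d x P) :
    IsSymbol C e (r d) (f x) (D P) := by
  have h1 : IsSymbol C e (r d) (f (quant C e P)) (D P) := by
    have h2 : D P = ∑ m ∈ P.support, coeff m P • D (monomial m 1) := by
      conv_lhs => rw [P.as_sum]
      rw [map_sum]
      refine Finset.sum_congr rfl fun m _ => ?_
      rw [← map_smul, smul_monomial, smul_eq_mul, mul_one]
    rw [h2, quant_eq_sum, map_sum]
    refine IsSymbol.sum _ fun m hm => ?_
    rw [map_smul]
    refine IsSymbol.smul _ ?_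
    have h3 := hf (Finsupp.toMultiset m).toList
    have h4 : (Finsupp.toMultiset m).toList.length = d := by
      rw [← wt_one, wt_toList, mwt_one, degree_of_mem_support hx.1 hm]
    rwa [prod_map_X (m := m) (by simp), h4] at h3
  have h5 := hlow d _ hx.2
  rw [map_sub] at h5
  simpa using (IsSymbol.zero_of_mem h5).add h1

variable (C) in
theorem IsSymbol.unique (hc : CommLower C e fun _ => 1)
    (hq : Function.Injective (quant C e)) {d : ℕ} {x : R} {P Q : MvPolynomial ι C}
    (hP : IsSymbol C e d x P) (hQ : IsSymbol C e d x Q) : P = Q := by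
  have h := sub_mem hQ.2 hP.2
  rw [sub_sub_sub_cancel_left, ← map_sub] at h
  obtain ⟨P', hP', h'⟩ := hc.Fil_le_map d h
  have h2 := hq h'
  rw [← sub_eq_zero]
  by_contra h3
  obtain ⟨m, hm⟩ := support_nonempty.2 h3
  have h4 := degree_of_mem_support (hP.1.sub hQ.1) hm
  rw [← h2] at hm
  have := hP' m hm
  rw [mwt_one] at this
  omega

theorem eq_zero_of_pderiv_eq_zero [IsDomain C] [CharZero C] {P : MvPolynomial ι C} {d : ℕ}
    (hP : P.IsHomogeneous (d + 1)) (h : ∀ i, pderiv i P = 0) : P = 0 := by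
  by_contra h0
  obtain ⟨m, hm⟩ := support_nonempty.2 h0
  have h1 := degree_of_mem_support hP hm
  have : m ≠ 0 := by rintro rfl; simp at h1
  obtain ⟨i, hi⟩ := Finsupp.ne_iff.1 this
  have h2 := congrArg (coeff (m - Finsupp.single i 1)) (h i)
  have h3 : m - Finsupp.single i 1 + Finsupp.single i 1 = m :=
    tsub_add_cancel_of_le (by simpa [Nat.one_le_iff_ne_zero] using hi)
  rw [coeff_pderiv, h3, coeff_zero] at h2
  rcases mul_eq_zero.1 h2 with h2 | h2
  · exact MvPolynomial.mem_support_iff.1 hm h2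
  · norm_cast at h2

theorem degree_le_totalDegree {P : MvPolynomial ι C} {m : ι →₀ ℕ} (hm : m ∈ P.support) :
    m.degree ≤ P.totalDegree :=
  le_totalDegree hm

theorem exists_degree_eq_totalDegree {P : MvPolynomial ι C} (hP : P ≠ 0) :
    ∃ m ∈ P.support, m.degree = P.totalDegree := by
  obtain ⟨m, hm, h⟩ := Finset.exists_mem_eq_sup P.support (support_nonempty.2 hP)
    (fun m => m.sum fun _ n => n)
  exact ⟨m, hm, h.symm⟩

theorem isSymbol_quant_top (P : MvPolynomial ι C) :
    IsSymbol C e P.totalDegree (quant C e P) (homogeneousComponent P.totalDegree P) := by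
  refine ⟨homogeneousComponent_isHomogeneous _ _, ?_⟩
  rw [← map_sub]
  refine quant_mem_Fil fun m hm => ?_
  rw [mwt_one]
  rw [mem_support_iff, coeff_sub, coeff_homogeneousComponent] at hm
  split_ifs at hm with h0
  · simp at hm
  · rw [sub_zero, ← mem_support_iff] at hm
    exact lt_of_le_of_ne (degree_le_totalDegree hm) h0

theorem mem_support_top {P : MvPolynomial ι C} {m : ι →₀ ℕ} :
    m ∈ (homogeneousComponent P.totalDegree P).support ↔
      m ∈ P.support ∧ m.degree = P.totalDegree := by
  rw [mem_support_iff, coeff_homogeneousComponent, mem_support_iff]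
  split_ifs with h <;> simp [h]

end WeightedWords

/-! ### Algebras generated by a family with the commutation relations of the Witt algebra -/

open WeightedWords MvPolynomial

/-- The algebra `R` over `C` is generated by the `e i`, `i ∈ I`, which satisfy the relations of the
Witt algebra up to a central extension. -/
structure IsWittLike (C : Type*) {R : Type*} [CommRing C] [Ring R] [Algebra C R] (I : Set ℤ)
    (e : ℤ → R) : Prop where
  one_mem : 1 ∈ I
  upper : IsUpperSet I
  add_mem : ∀ i ∈ I, ∀ j ∈ I, i ≠ j → i + j ∈ I
  comm : ∀ i ∈ I, ∀ j ∈ I, ∃ z : C, (i + j ≠ 0 → z = 0) ∧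
    e i * e j - e j * e i = ((j - i : ℤ) : C) • e (i + j) + algebraMap C R z
  gen : Algebra.adjoin C (e '' I) = ⊤

namespace IsWittLike

variable {C R : Type*} [CommRing C] [Ring R] [Algebra C R] {I : Set ℤ} {e : ℤ → R}

/-- The generators with index in `I`. -/
def gens (I : Set ℤ) (e : ℤ → R) (i : I) : R := e i

theorem adjoin_gens (h : IsWittLike C I e) : Algebra.adjoin C (Set.range (gens I e)) = ⊤ := by
  rw [← h.gen]; congr 1; ext x; simp [gens]

theorem algebraMap_mem_Fil {ι : Type*} {f : ι → R} {w : ι → ℕ} (z : C) :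
    algebraMap C R z ∈ Fil C f w 1 := by
  have : word f [] ∈ Fil C f w 1 := word_mem_Fil (by simp)
  rw [Algebra.algebraMap_eq_smul_one]
  exact Submodule.smul_mem _ _ this

theorem gens_mem_Fil {w : I → ℕ} (i : I) : gens I e i ∈ Fil C (gens I e) w (w i + 1) := by
  have : word (gens I e) [i] ∈ Fil C (gens I e) w (w i + 1) := word_mem_Fil (by simp)
  simpa using this

theorem commLower (h : IsWittLike C I e) (w : ℤ → ℕ) (hw : ∀ i, 1 ≤ w i)
    (hadd : ∀ i j, w (i + j) < w i + w j) : CommLower C (gens I e) fun i => w i := by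
  intro i j
  obtain ⟨z, -, hz⟩ := h.comm i i.2 j j.2
  rw [gens, gens, hz]
  have h1 := hw i
  have h2 := hw j
  refine Submodule.add_mem _ ?_ (Fil_mono (show 1 ≤ w i + w j by omega) (algebraMap_mem_Fil z))
  by_cases hij : (i : ℤ) = j
  · simp [hij]
  · refine Submodule.smul_mem _ _ ?_
    have := gens_mem_Fil (C := C) (e := e) (w := fun i => w i) ⟨_, h.add_mem i i.2 j j.2 hij⟩
    exact Fil_mono (hadd i j) this

theorem commLower_one (h : IsWittLike C I e) : CommLower C (gens I e) fun _ => 1 :=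
  h.commLower (fun _ => 1) (fun _ => le_rfl) (fun _ _ => by norm_num)

theorem quant_surjective (h : IsWittLike C I e) : Function.Surjective (quant C (gens I e)) := by
  intro x
  obtain ⟨s, hs⟩ := exists_mem_Fil (w := fun _ => 1) h.adjoin_gens x
  obtain ⟨P, -, hP⟩ := h.commLower_one.Fil_le_map s hs
  exact ⟨P, hP⟩

/-! #### Independence of the monomials -/

/-- A family of linear maps that act on symbols as the partial derivatives. -/
structure HasDerivatives (C : Type*) {R : Type*} [CommRing C] [Ring R] [Algebra C R] (I : Set ℤ)
    (e : ℤ → R) (θ : ℤ → R →ₗ[C] R) : Prop where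
  map_one : ∀ n, θ n 1 = 0
  map_mul : ∀ n, ∀ k ∈ I, ∀ u, θ n (e k * u) =
    (if n = k then u else 0) + e k * θ n u + ((n - k : ℤ) : C) • θ (n - k) u

theorem HasDerivatives.word_mem {θ : ℤ → R →ₗ[C] R} (hθ : HasDerivatives C I e θ) (n : ℤ)
    (l : List I) : θ n (word (gens I e) l) ∈ DegFil C (gens I e) l.length := by
  induction l generalizing n with
  | nil => simp [hθ.map_one]
  | cons k l ih =>
    rw [word_cons, gens, hθ.map_mul n k k.2, List.length_cons]
    refine Submodule.add_mem _ (Submodule.add_mem _ ?_ ?_)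
      (Submodule.smul_mem _ _ (Fil_mono (Nat.le_succ _) (ih _)))
    · split_ifs
      · exact word_mem_Fil (by simp [wt_one])
      · exact zero_mem _
    · have := word_mul_mem_Fil [k] (ih n)
      simp only [word_cons, word_nil, mul_one, gens, wt_cons, wt_nil] at this
      exact Fil_mono (by omega) this

theorem HasDerivatives.map_mem {θ : ℤ → R →ₗ[C] R} (hθ : HasDerivatives C I e θ) (n : ℤ)
    (d : ℕ) (x : R) (hx : x ∈ DegFil C (gens I e) d) : θ n x ∈ DegFil C (gens I e) (d - 1) := by
  refine (Fil_le (N := (DegFil C (gens I e) (d - 1)).comap (θ n)) fun l hl => ?_) hx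
  rw [wt_one] at hl
  exact Fil_mono (by omega) (hθ.word_mem n l)

theorem HasDerivatives.isSymbol_word {θ : ℤ → R →ₗ[C] R} (hθ : HasDerivatives C I e θ)
    (hc : CommLower C (gens I e) fun _ => 1) (n : I)
    (l : List I) : IsSymbol C (gens I e) (l.length - 1) (θ n (word (gens I e) l))
      (pderiv n (l.map X).prod) := by
  classical
  induction l with
  | nil =>
    simpa [hθ.map_one] using IsSymbol.zero_of_mem (C := C) (e := gens I e) (zero_mem _)
  | cons k l ih =>
    rw [word_cons, gens, hθ.map_mul n k k.2, List.length_cons, Nat.add_sub_cancel, List.map_cons,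
      List.prod_cons, Derivation.leibniz, smul_eq_mul, smul_eq_mul, pderiv_X, add_comm (X k * _),
      Pi.single_apply, ← add_zero (_ + X k * _)]
    refine IsSymbol.add (IsSymbol.add ?_ ?_) (IsSymbol.zero_of_mem ?_)
    · rcases eq_or_ne n k with rfl | hnk
      · simpa using WeightedWords.isSymbol_word hc l
      · rw [if_neg (fun h => hnk (Subtype.ext h)), if_neg (Ne.symm hnk), mul_zero]
        exact IsSymbol.zero_of_mem (zero_mem _)
    · cases l with
      | nil => simpa [hθ.map_one] using IsSymbol.zero_of_mem (C := C) (e := gens I e) (zero_mem _)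
      | cons k' l =>
        have h1 := (WeightedWords.isSymbol_word hc [k]).mul hc ih
        simp only [List.length_cons, List.length_nil, zero_add, Nat.add_sub_cancel, word_cons,
          word_nil, mul_one, List.map_cons, List.map_nil, List.prod_cons, List.prod_nil] at h1 ⊢
        rw [add_comm 1] at h1
        exact h1
    · exact Submodule.smul_mem _ _ (hθ.word_mem _ l)

theorem HasDerivatives.isSymbol {θ : ℤ → R →ₗ[C] R} (hθ : HasDerivatives C I e θ)
    (hc : CommLower C (gens I e) fun _ => 1) (n : I) {d : ℕ} {x : R} {P : MvPolynomial I C}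
    (hx : IsSymbol C (gens I e) d x P) : IsSymbol C (gens I e) (d - 1) (θ n x) (pderiv n P) :=
  hx.map (θ n) (pderiv n).toLinearMap (r := fun d => d - 1)
    (fun l => hθ.isSymbol_word hc n l) (fun d x hx => hθ.map_mem n d x hx)

theorem HasDerivatives.eq_zero [IsDomain C] [CharZero C] {θ : ℤ → R →ₗ[C] R}
    (hθ : HasDerivatives C I e θ) (hc : CommLower C (gens I e) fun _ => 1)
    (hinj : Function.Injective (algebraMap C R)) (d : ℕ) (P : MvPolynomial I C)
    (hP : IsSymbol C (gens I e) d 0 P) : P = 0 := by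
  induction d generalizing P with
  | zero =>
    have h1 : P.totalDegree = 0 := (totalDegree_zero_iff_isHomogeneous _).2 hP.1
    rw [totalDegree_eq_zero_iff_eq_C] at h1
    have h2 := hP.2
    rw [h1, quant_C, DegFil, Fil_zero, Submodule.mem_bot, zero_sub, neg_eq_zero,
      map_eq_zero_iff _ hinj] at h2
    rw [h1, h2, C_0]
  | succ d ih =>
    refine eq_zero_of_pderiv_eq_zero hP.1 fun n => ih _ ?_
    simpa using hθ.isSymbol hc n hP

/-- The Poincaré–Birkhoff–Witt property. -/
theorem quant_injective [IsDomain C] [CharZero C] (h : IsWittLike C I e) {θ : ℤ → R →ₗ[C] R}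
    (hθ : HasDerivatives C I e θ) (hinj : Function.Injective (algebraMap C R)) :
    Function.Injective (quant C (gens I e)) := by
  rw [injective_iff_map_eq_zero]
  intro P hP
  have hc := h.commLower_one
  have key := isSymbol_quant_top (e := gens I e) P
  rw [hP] at key
  have h1 := hθ.eq_zero hc hinj _ _ key
  by_contra h0
  obtain ⟨m, hm, hm'⟩ := exists_degree_eq_totalDegree h0
  have h2 := mem_support_top.2 ⟨hm, hm'⟩
  simp [h1] at h2

end IsWittLike

/-! ### Proportionality of polynomials -/

section Leading

variable {C ι : Type*} [CommRing C]

theorem coeff_mul_of_lex_max [LinearOrder ι] {P Q : MvPolynomial ι C} {m m' : ι →₀ ℕ}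
    (hP : ∀ x ∈ P.support, toLex x ≤ toLex m) (hQ : ∀ x ∈ Q.support, toLex x ≤ toLex m') :
    coeff (m + m') (P * Q) = coeff m P * coeff m' Q := by
  classical
  rw [coeff_mul, Finset.sum_eq_single (m, m')]
  · rintro ⟨x, y⟩ hxy hne
    by_contra h0
    have hx := hP x (mem_support_iff.2 (left_ne_zero_of_mul h0))
    have hy := hQ y (mem_support_iff.2 (right_ne_zero_of_mul h0))
    have hs : toLex x + toLex y = toLex m + toLex m' :=
      congrArg (toLex : (ι →₀ ℕ) → _) (Finset.HasAntidiagonal.mem_antidiagonal.1 hxy)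
    have h1 := (add_eq_add_iff_eq_and_eq hx hy).1 hs
    exact hne (Prod.ext (toLex.injective h1.1) (toLex.injective h1.2))
  · simp

theorem coeff_X_mul_pderiv (P : MvPolynomial ι C) (k : ι) (m : ι →₀ ℕ) :
    coeff m (X k * pderiv k P) = m k * coeff m P := by
  classical
  induction P using MvPolynomial.induction_on' with
  | add p q hp hq => simp [hp, hq, mul_add]
  | monomial n a =>
    rw [X_mul_pderiv_monomial, coeff_smul, coeff_monomial]
    split_ifs with h
    · simp [h]
    · simp

theorem lex_max_eq_of_pderiv_mul [IsDomain C] [CharZero C] [LinearOrder ι] {P Q : MvPolynomial ι C}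
    (h : ∀ k, pderiv k P * Q = pderiv k Q * P) {m m' : ι →₀ ℕ}
    (hm : m ∈ P.support) (hm' : m' ∈ Q.support)
    (hP : ∀ x ∈ P.support, toLex x ≤ toLex m) (hQ : ∀ x ∈ Q.support, toLex x ≤ toLex m') :
    m = m' := by
  have hsupp : ∀ (F : MvPolynomial ι C) (k : ι), (X k * pderiv k F).support ⊆ F.support := by
    intro F k x hx
    rw [mem_support_iff, coeff_X_mul_pderiv] at hx
    exact mem_support_iff.2 (right_ne_zero_of_mul hx)
  ext k
  have h1 := congrArg (fun F => coeff (m + m') (X k * F)) (h k)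
  simp only [← mul_assoc] at h1
  rw [coeff_mul_of_lex_max (fun x hx => hP x (hsupp P k hx)) hQ, add_comm m m',
    coeff_mul_of_lex_max (fun x hx => hQ x (hsupp Q k hx)) hP, coeff_X_mul_pderiv,
    coeff_X_mul_pderiv, mul_assoc, mul_assoc, mul_comm (coeff m' Q)] at h1
  have h2 := mul_right_cancel₀
    (mul_ne_zero (mem_support_iff.1 hm) (mem_support_iff.1 hm')) h1
  exact_mod_cast h2

end Leading

namespace IsWittLike

variable {C R : Type*} [CommRing C] [Ring R] [Algebra C R] {I : Set ℤ} {e : ℤ → R}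

variable (C I) in
/-- The variable with index `j`, or `0` if `j ∉ I`. -/
def var (j : ℤ) : MvPolynomial I C := by
  classical exact if h : j ∈ I then X ⟨j, h⟩ else 0

theorem var_of_mem {j : ℤ} (h : j ∈ I) : var C I j = X ⟨j, h⟩ := by simp [var, h]

theorem var_of_notMem {j : ℤ} (h : j ∉ I) : var C I j = 0 := by simp [var, h]

variable (C I) in
/-- The derivation of the polynomial ring given by the Poisson bracket with the variable `n`. -/
def poisson (n : ℤ) : Derivation C (MvPolynomial I C) (MvPolynomial I C) :=
  mkDerivation C fun k : I => ((k - n : ℤ) : C) • var C I (n + k)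

theorem poisson_X (n : ℤ) (k : I) :
    poisson C I n (X k) = ((k - n : ℤ) : C) • var C I (n + k) := mkDerivation_X _ _ _

theorem isSymbol_commutator_gens (h : IsWittLike C I e) (n k : I) :
    IsSymbol C (gens I e) 1 (e n * e k - e k * e n) (poisson C I n (X k)) := by
  obtain ⟨z, -, hz⟩ := h.comm n n.2 k k.2
  rw [hz, poisson_X, ← add_zero ((_ : C) • var C I _)]
  refine IsSymbol.add ?_ (IsSymbol.zero_of_mem (algebraMap_mem_Fil z))
  by_cases hnk : (n : ℤ) = k
  · simpa [hnk] using IsSymbol.zero_of_mem (C := C) (e := gens I e) (zero_mem _)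
  · have hm := h.add_mem n n.2 k k.2 hnk
    have := WeightedWords.isSymbol_word h.commLower_one [(⟨_, hm⟩ : I)]
    rw [var_of_mem hm]
    exact IsSymbol.smul _ (by simpa [gens] using this)

theorem isSymbol_commutator_word (h : IsWittLike C I e) (n : I) (l : List I) :
    IsSymbol C (gens I e) l.length (e n * word (gens I e) l - word (gens I e) l * e n)
      (poisson C I n (l.map X).prod) := by
  have hc := h.commLower_one
  induction l with
  | nil => simpa using IsSymbol.zero_of_mem (C := C) (e := gens I e) (zero_mem _)
  | cons k l ih =>
    have h1 := (h.isSymbol_commutator_gens n k).mul hc (WeightedWords.isSymbol_word hc l)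
    have h2 := (WeightedWords.isSymbol_word hc [k]).mul hc ih
    have h3 := h1.add h2
    simp only [word_cons, word_nil, List.map_cons, List.map_nil, List.prod_cons, List.prod_nil,
      mul_one, List.length_cons] at h3 ⊢
    rw [add_comm 1] at h3
    convert h3 using 1
    · simp only [gens]; noncomm_ring
    · rw [Derivation.leibniz, smul_eq_mul, smul_eq_mul]; ring

theorem isSymbol_commutator (h : IsWittLike C I e) (n : I) {d : ℕ} {x : R} {P : MvPolynomial I C}
    (hx : IsSymbol C (gens I e) d x P) :
    IsSymbol C (gens I e) d (e n * x - x * e n) (poisson C I n P) := by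
  refine hx.map (LinearMap.mulLeft C (e n) - LinearMap.mulRight C (e n))
    (poisson C I n).toLinearMap (r := id) (fun l => h.isSymbol_commutator_word n l) fun d x hx => ?_
  refine (Fil_le (N := (DegFil C (gens I e) d).comap
    (LinearMap.mulLeft C (e n) - LinearMap.mulRight C (e n))) fun l hl => ?_) hx
  rw [wt_one] at hl
  exact Fil_mono hl (h.isSymbol_commutator_word n l).mem

theorem pderiv_poisson (n : ℤ) (j k : I) (hj : (j : ℤ) = n + k) (P : MvPolynomial I C) :
    pderiv j (poisson C I n P) =
      ((k - n : ℤ) : C) • pderiv k P + poisson C I n (pderiv j P) := by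
  classical
  have : ⁅pderiv (R := C) j, poisson C I n⁆ = ((k - n : ℤ) : C) • pderiv k := by
    refine derivation_ext fun i => ?_
    rw [Derivation.commutator_apply, poisson_X, Derivation.smul_apply, pderiv_X, pderiv_X,
      Derivation.map_smul]
    have h0 : poisson C I n ((Pi.single j 1 : I → MvPolynomial I C) i) = 0 := by
      rw [Pi.single_apply]; split_ifs <;> simp
    rw [h0, sub_zero]
    by_cases hi : n + (i : ℤ) ∈ I
    · rw [var_of_mem hi, pderiv_X, Pi.single_apply, Pi.single_apply]
      rcases eq_or_ne i k with rfl | hik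
      · rw [if_pos (Subtype.ext hj.symm), if_pos rfl]
      · rw [if_neg, if_neg hik, smul_zero, smul_zero]
        intro h
        apply hik
        have := congrArg Subtype.val h
        ext
        simp only at this
        omega
    · rw [var_of_notMem hi, map_zero, smul_zero, Pi.single_apply, if_neg, smul_zero]
      rintro rfl
      exact hi (hj ▸ j.2)
  rw [← Derivation.smul_apply, ← this, Derivation.commutator_apply]
  abel

/-- Elements `a`, `b` with `a x b = b x a` for all `x` have proportional symbols. -/
theorem pderiv_mul_eq_of_exchange [IsDomain C] [CharZero C] (h : IsWittLike C I e)
    (hq : Function.Injective (quant C (gens I e))) {a b : R} (hab : ∀ x, a * x * b = b * x * a)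
    {d d' : ℕ} {P Q : MvPolynomial I C} (hP : IsSymbol C (gens I e) d a P)
    (hQ : IsSymbol C (gens I e) d' b Q) (k : I) : pderiv k P * Q = pderiv k Q * P := by
  classical
  have hc := h.commLower_one
  have key : ∀ n : I, poisson C I n P * Q = poisson C I n Q * P := by
    intro n
    have h1 := ((h.isSymbol_commutator n hP).mul hc hQ)
    have h2 := ((h.isSymbol_commutator n hQ).mul hc hP)
    rw [add_comm d' d] at h2
    have h3 := h1.sub h2
    have h4 : (e n * a - a * e n) * b - (e n * b - b * e n) * a = 0 := by
      have e1 := hab 1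
      have e2 := hab (e n)
      rw [mul_one, mul_one] at e1
      rw [sub_mul, sub_mul, e2, mul_assoc, mul_assoc, e1]
      noncomm_ring
    rw [h4] at h3
    exact sub_eq_zero.1
      (IsSymbol.unique C hc hq h3 (IsSymbol.zero_of_mem (zero_mem _)))
  obtain ⟨N, hN⟩ := ((P.vars ∪ Q.vars).image (fun i : I => (i : ℤ))).bddAbove
  have hN' : ∀ i ∈ P.vars ∪ Q.vars, (i : ℤ) ≤ N := fun i hi =>
    hN (Finset.mem_coe.2 (Finset.mem_image_of_mem _ hi))
  set n : ℤ := 1 + |N| + |(k : ℤ)| with hn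
  have a1 := abs_nonneg N
  have a2 := abs_nonneg (k : ℤ)
  have a3 := le_abs_self N
  have a4 := neg_abs_le (k : ℤ)
  have a5 := le_abs_self (k : ℤ)
  have hnI : n ∈ I := h.upper (show 1 ≤ n by omega) h.one_mem
  have hjI : n + k ∈ I := h.upper (show (k : ℤ) ≤ n + k by omega) k.2
  have hj : (⟨n + k, hjI⟩ : I) ∉ P.vars ∪ Q.vars := fun hmem => by
    have := hN' _ hmem
    simp only at this
    omega
  rw [Finset.mem_union, not_or] at hj
  have h1 := congrArg (pderiv ⟨n + k, hjI⟩) (key ⟨n, hnI⟩)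
  rw [Derivation.leibniz, Derivation.leibniz, pderiv_poisson n ⟨n + k, hjI⟩ k rfl,
    pderiv_poisson n ⟨n + k, hjI⟩ k rfl, pderiv_eq_zero_of_notMem_vars hj.1,
    pderiv_eq_zero_of_notMem_vars hj.2, map_zero, smul_zero, smul_zero, add_zero, zero_add,
    zero_add, add_zero, smul_eq_mul, smul_eq_mul, mul_smul_comm, mul_smul_comm] at h1
  have h2 : ((k - n : ℤ) : C) ≠ 0 := by
    rw [Int.cast_ne_zero]; omega
  have h3 := smul_right_injective _ h2 h1
  rw [mul_comm, h3, mul_comm]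

theorem exists_leading {P : MvPolynomial I C} (hP : P ≠ 0) : ∃ m ∈ P.support,
    m.degree = P.totalDegree ∧
    ∀ x ∈ (homogeneousComponent P.totalDegree P).support, toLex x ≤ toLex m := by
  obtain ⟨m, hm, hm'⟩ := exists_degree_eq_totalDegree hP
  obtain ⟨x, hx, hmax⟩ := Finset.exists_max_image
    (homogeneousComponent P.totalDegree P).support toLex ⟨m, mem_support_top.2 ⟨hm, hm'⟩⟩
  obtain ⟨h1, h2⟩ := mem_support_top.1 hx
  exact ⟨x, h1, h2, hmax⟩

theorem leading_eq [IsDomain C] [CharZero C] (h : IsWittLike C I e)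
    (hq : Function.Injective (quant C (gens I e))) {P Q : MvPolynomial I C}
    (hab : ∀ x, quant C (gens I e) P * x * quant C (gens I e) Q =
      quant C (gens I e) Q * x * quant C (gens I e) P) {m m' : I →₀ ℕ}
    (hm : m ∈ P.support ∧ m.degree = P.totalDegree ∧
      ∀ x ∈ (homogeneousComponent P.totalDegree P).support, toLex x ≤ toLex m)
    (hm' : m' ∈ Q.support ∧ m'.degree = Q.totalDegree ∧
      ∀ x ∈ (homogeneousComponent Q.totalDegree Q).support, toLex x ≤ toLex m') : m = m' :=
  lex_max_eq_of_pderiv_mul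
    (h.pderiv_mul_eq_of_exchange hq hab (isSymbol_quant_top P) (isSymbol_quant_top Q))
    (mem_support_top.2 ⟨hm.1, hm.2.1⟩) (mem_support_top.2 ⟨hm'.1, hm'.2.1⟩) hm.2.2 hm'.2.2

/-- Elements `a`, `b` with `a x b = b x a` for all `x` are proportional. -/
theorem proportional_of_exchange [IsDomain C] [CharZero C] (h : IsWittLike C I e)
    (hq : Function.Injective (quant C (gens I e))) {a b : R} (ha : a ≠ 0)
    (hab : ∀ x, a * x * b = b * x * a) : ∃ p r : C, p ≠ 0 ∧ p • b = r • a := by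
  obtain ⟨P, rfl⟩ := h.quant_surjective a
  obtain ⟨Q, rfl⟩ := h.quant_surjective b
  have hP : P ≠ 0 := by rintro rfl; simp at ha
  obtain ⟨m, hm⟩ := exists_leading hP
  refine ⟨coeff m P, coeff m Q, mem_support_iff.1 hm.1, ?_⟩
  rw [← map_smul, ← map_smul, ← sub_eq_zero, ← map_sub]
  by_contra h0
  have h1 : coeff m P • Q - coeff m Q • P ≠ 0 := fun h1 => h0 (by rw [h1, map_zero])
  obtain ⟨m', hm'⟩ := exists_leading h1
  have h2 := h.leading_eq hq (P := P) (Q := coeff m P • Q - coeff m Q • P) (fun x => by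
    simp only [map_sub, map_smul, mul_sub, sub_mul, mul_smul_comm, smul_mul_assoc, hab x]) hm hm'
  have h3 := mem_support_iff.1 hm'.1
  rw [← h2] at h3
  apply h3
  simp [mul_comm]

/-- The center consists of scalars, up to denominators. -/
theorem exists_smul_eq_of_central [IsDomain C] [CharZero C] [Nontrivial R] (h : IsWittLike C I e)
    (hq : Function.Injective (quant C (gens I e))) {z : R} (hz : ∀ x, z * x = x * z) :
    ∃ c : C, algebraMap C R c = z := by
  obtain ⟨p, r, hp, hpr⟩ := h.proportional_of_exchange hq (one_ne_zero (α := R)) (b := z)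
    (fun x => by rw [one_mul, mul_one, hz])
  obtain ⟨P, rfl⟩ := h.quant_surjective z
  have h1 : p • P = MvPolynomial.C r := hq (by
    rw [map_smul, hpr, quant_C, Algebra.algebraMap_eq_smul_one])
  refine ⟨coeff 0 P, ?_⟩
  rw [← quant_C (e := gens I e)]
  congr 1
  ext m
  rw [coeff_C]
  split_ifs with hm
  · rw [← hm]
  · have := congrArg (coeff m) h1
    rw [coeff_smul, coeff_C, if_neg hm, smul_eq_mul] at this
    exact ((mul_eq_zero.1 this).resolve_left hp).symm

end IsWittLike

/-! ### Iterated commutators -/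

section Commutators

variable {C R : Type*} [CommRing C] [Ring R] [Algebra C R]

theorem commutator_prod_ofFn {d : ℕ} (a : R) (f : Fin d → R) :
    a * (List.ofFn f).prod - (List.ofFn f).prod * a =
      ∑ j, (List.ofFn (Function.update f j (a * f j - f j * a))).prod := by
  induction d with
  | zero => simp
  | succ d ih =>
    have h1 : ∀ j : Fin d, (List.ofFn (Function.update f j.succ (a * f j.succ - f j.succ * a))).prod
        = f 0 * (List.ofFn (Function.update (fun i : Fin d => f i.succ) j
          (a * f j.succ - f j.succ * a))).prod := by
      intro j
      rw [List.ofFn_succ, List.prod_cons, Function.update_of_ne (Fin.succ_ne_zero j).symm]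
      congr 3
      ext i
      exact Function.update_apply_of_injective f (Fin.succ_injective d) j _ i
    have h2 : (List.ofFn (Function.update f 0 (a * f 0 - f 0 * a))).prod =
        (a * f 0 - f 0 * a) * (List.ofFn (fun i : Fin d => f i.succ)).prod := by
      rw [List.ofFn_succ, List.prod_cons, Function.update_self]
      congr 3
    rw [Fin.sum_univ_succ, h2, Finset.sum_congr rfl fun j _ => h1 j, ← Finset.mul_sum, ← ih,
      List.ofFn_succ, List.prod_cons]
    noncomm_ring

/-- The sum of the `n i` over the fibre of `g` at `j`. -/
def fiberSum {r d : ℕ} (n : Fin r → ℤ) (g : Fin r → Fin d) (j : Fin d) : ℤ :=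
  ∑ i, if g i = j then n i else 0

theorem fiberSum_cons {r d : ℕ} (n : Fin (r + 1) → ℤ) (a : Fin d) (g : Fin r → Fin d)
    (j : Fin d) : fiberSum n (Fin.cons a g) j =
      (if a = j then n 0 else 0) + fiberSum (Fin.tail n) g j := by
  simp [fiberSum, Fin.sum_univ_succ, Fin.tail]

end Commutators

namespace IsWittLike

variable {C R : Type*} [CommRing C] [Ring R] [Algebra C R] {I : Set ℤ} {e : ℤ → R}

theorem commutator_eq (h : IsWittLike C I e) {i j : ℤ} (hi : i ∈ I) (hj : j ∈ I)
    (hij : i + j ≠ 0) : e i * e j - e j * e i = ((j - i : ℤ) : C) • e (i + j) := by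
  obtain ⟨z, hz, hz'⟩ := h.comm i hi j hj
  rw [hz', hz hij, map_zero, add_zero]

theorem mul_fiberSum_nonneg {r d : ℕ} {ε : ℤ} {n : Fin r → ℤ} (hn : ∀ i, 0 < ε * n i)
    (g : Fin r → Fin d) (j : Fin d) : 0 ≤ ε * fiberSum n g j := by
  rw [fiberSum, Finset.mul_sum]
  refine Finset.sum_nonneg fun i _ => ?_
  split_ifs
  · exact (hn i).le
  · simp

theorem fiberSum_eq_zero {r d : ℕ} {n : Fin r → ℤ} {g : Fin r → Fin d} {j : Fin d}
    (hj : ∀ i, g i ≠ j) : fiberSum n g j = 0 :=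
  Finset.sum_eq_zero fun i _ => if_neg (hj i)

theorem fiberSum_apply {r d : ℕ} {n : Fin r → ℤ} {g : Fin r → Fin d}
    (hg : Function.Injective g) (i : Fin r) : fiberSum n g (g i) = n i := by
  rw [fiberSum, Finset.sum_eq_single i]
  · simp
  · exact fun i' _ hi' => if_neg (hg.ne hi')
  · simp

theorem add_fiberSum_mem {ε : ℤ} (hε : ∀ x, 0 < ε * x → x ∈ I) {r d : ℕ} {n : Fin r → ℤ}
    (hn : ∀ i, 0 < ε * n i) {k : Fin d → ℤ} (hk : ∀ j, k j ∈ I)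
    (hnk : ∀ i j, 0 < ε * (n i + k j)) (g : Fin r → Fin d) (j : Fin d) :
    k j + fiberSum n g j ∈ I := by
  by_cases hj : ∃ i, g i = j
  · obtain ⟨i, hi⟩ := hj
    apply hε
    have h1 : fiberSum n g j = n i + ∑ i' ∈ Finset.univ.erase i, if g i' = j then n i' else 0 := by
      rw [fiberSum, ← Finset.add_sum_erase _ _ (Finset.mem_univ i), if_pos hi]
    have h2 : 0 ≤ ε * ∑ i' ∈ Finset.univ.erase i, if g i' = j then n i' else 0 := by
      rw [Finset.mul_sum]
      refine Finset.sum_nonneg fun i _ => ?_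
      split_ifs
      · exact (hn i).le
      · simp
    have h3 := hnk i j
    rw [h1]
    linarith
  · push Not at hj
    rw [fiberSum_eq_zero hj, add_zero]
    exact hk j

/-- Iterated commutators with generators of a product of generators. -/
theorem exists_iterated_commutator (h : IsWittLike C I e) {ε : ℤ}
    (hε : ∀ x, 0 < ε * x → x ∈ I) (r : ℕ) (n : Fin r → ℤ) (hn : ∀ i, 0 < ε * n i) :
    ∃ D : R →ₗ[C] R, ∀ (d : ℕ) (k : Fin d → ℤ), (∀ j, k j ∈ I) → (∀ i j, 0 < ε * (n i + k j)) →
      ∃ c : (Fin r → Fin d) → C, (∀ g, Function.Injective g →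
        c g = ∏ i, ((k (g i) - n i : ℤ) : C)) ∧
        D (List.ofFn fun j => e (k j)).prod =
          ∑ g, c g • (List.ofFn fun j => e (k j + fiberSum n g j)).prod := by
  induction r with
  | zero =>
    refine ⟨LinearMap.id, fun d k _ _ => ⟨fun _ => 1, fun g _ => by simp, ?_⟩⟩
    simp [fiberSum]
  | succ r ih =>
    obtain ⟨D, hD⟩ := ih (Fin.tail n) (fun i => hn i.succ)
    refine ⟨(LinearMap.mulLeft C (e (n 0)) - LinearMap.mulRight C (e (n 0))) ∘ₗ D,
      fun d k hk hnk => ?_⟩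
    obtain ⟨c, hc, hc'⟩ := hD d k hk fun i j => hnk i.succ j
    refine ⟨fun f => c (Fin.tail f) *
      ((k (f 0) + fiberSum (Fin.tail n) (Fin.tail f) (f 0) - n 0 : ℤ) : C), fun f hf => ?_, ?_⟩
    · have h1 : Function.Injective (Fin.tail f) := hf.comp (Fin.succ_injective r)
      beta_reduce
      rw [hc _ h1, Fin.prod_univ_succ, fiberSum_eq_zero, add_zero, mul_comm]
      · rfl
      · exact fun i hi => Fin.succ_ne_zero i (hf hi)
    · rw [LinearMap.comp_apply, hc', map_sum,
        ← (Fin.consEquiv fun _ => Fin d).sum_comp, Fintype.sum_prod_type, Finset.sum_comm]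
      refine Finset.sum_congr rfl fun g _ => ?_
      rw [map_smul, LinearMap.sub_apply, LinearMap.mulLeft_apply, LinearMap.mulRight_apply,
        commutator_prod_ofFn, Finset.smul_sum]
      refine Finset.sum_congr rfl fun a _ => ?_
      have hcons : (Fin.consEquiv fun _ => Fin d) (a, g) = (Fin.cons a g : Fin (r + 1) → Fin d) :=
        rfl
      simp only [hcons, Fin.tail_cons, Fin.cons_zero]
      rw [mul_smul]
      congr 1
      have h1 := add_fiberSum_mem hε (n := Fin.tail n) (fun i => hn i.succ) hk
        (fun i j => hnk i.succ j) g a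
      have h2 := mul_fiberSum_nonneg (n := Fin.tail n) (fun i => hn i.succ) g a
      have h3 := hnk 0 a
      have h4 : n 0 + (k a + fiberSum (Fin.tail n) g a) ≠ 0 := by
        intro h0
        have : ε * (n 0 + k a) + ε * fiberSum (Fin.tail n) g a = 0 := by
          rw [← mul_add, add_assoc, h0, mul_zero]
        linarith
      rw [h.commutator_eq (hε _ (hn 0)) h1 h4]
      have key : ∀ (f : Fin d → R) (z : C) (x : R),
          (List.ofFn (Function.update f a (z • x))).prod =
            z • (List.ofFn (Function.update f a x)).prod := by
        intro f z x
        have := (MultilinearMap.mkPiAlgebraFin C d R).map_update_smul f a z x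
        simpa only [MultilinearMap.mkPiAlgebraFin_apply] using this
      rw [key]
      congr 3
      ext j
      rcases eq_or_ne j a with rfl | hja
      · rw [Function.update_self, fiberSum_cons, if_pos rfl]
        congr 1; ring
      · rw [Function.update_of_ne hja, fiberSum_cons, if_neg hja.symm, zero_add]

end IsWittLike

/-! ### Monomials given by tuples of generators -/

section Tuples

variable {ι : Type*}

/-- The monomial with the factors `x i`. -/
def tup {d : ℕ} (x : Fin d → ι) : ι →₀ ℕ := ∑ i, Finsupp.single (x i) 1

theorem toMultiset_tup {d : ℕ} (x : Fin d → ι) :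
    Finsupp.toMultiset (tup x) = (List.ofFn x : Multiset ι) := by
  rw [tup, map_sum, ← Fin.univ_val_map]
  simp only [Finsupp.toMultiset_single, one_smul]
  rw [Finset.sum, show (fun i => ({x i} : Multiset ι)) = (fun i => {i}) ∘ x from rfl,
    ← Multiset.map_map, Multiset.sum_map_singleton]

theorem mwt_tup (w : ι → ℕ) {d : ℕ} (x : Fin d → ι) : mwt w (tup x) = ∑ i, w (x i) := by
  rw [mwt, toMultiset_tup]
  simp [List.sum_ofFn]

theorem degree_tup {d : ℕ} (x : Fin d → ι) : (tup x).degree = d := by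
  rw [← mwt_one, mwt_tup]; simp

theorem tup_comp {d d' : ℕ} (x : Fin d' → ι) {g : Fin d → Fin d'} (hg : Function.Bijective g) :
    tup (fun i => x (g i)) = tup x :=
  Fintype.sum_bijective g hg _ _ fun _ => rfl

theorem tup_apply [DecidableEq ι] {d : ℕ} (x : Fin d → ι) (v : ι) :
    tup x v = (Finset.univ.filter fun i => x i = v).card := by
  rw [tup, Finsupp.finsetSum_apply, Finset.card_filter]
  exact Finset.sum_congr rfl fun i _ => Finsupp.single_apply

theorem exists_equiv_of_tup_eq {d d' : ℕ} {k : Fin d' → ι} {κ : Fin d → ι} (h : tup k = tup κ) :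
    ∃ g : Fin d ≃ Fin d', ∀ i, k (g i) = κ i := by
  classical
  have h1 : ∀ v, Nonempty ({i // κ i = v} ≃ {j // k j = v}) := fun v => by
    refine ⟨Fintype.equivOfCardEq ?_⟩
    have h2 := DFunLike.congr_fun h v
    rw [tup_apply, tup_apply] at h2
    rw [Fintype.card_subtype, Fintype.card_subtype]
    convert h2.symm
  exact ⟨Equiv.ofFiberEquiv fun v => (h1 v).some, fun i => Equiv.ofFiberEquiv_map _ i⟩

theorem exists_tup_eq {R : Type*} [Ring R] (e : ι → R) (m : ι →₀ ℕ) :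
    ∃ (d : ℕ) (k : Fin d → ι), tup k = m ∧ mon e m = word e (List.ofFn k) := by
  refine ⟨(Finsupp.toMultiset m).toList.length, (Finsupp.toMultiset m).toList.get, ?_, ?_⟩
  · classical
    rw [← Finsupp.toMultiset_toFinsupp (tup _), toMultiset_tup, List.ofFn_get, Multiset.coe_toList,
      Finsupp.toMultiset_toFinsupp]
  · rw [List.ofFn_get, mon]

theorem tup_lt_tup [LinearOrder ι] {d : ℕ} {x y : Fin d → ι} (i₀ : Fin d)
    (h1 : ∀ i < i₀, x i = y i) (h2 : ∀ i, i₀ ≤ i → y i₀ < x i) (h3 : ∀ i, i₀ ≤ i → y i₀ ≤ y i) :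
    toLex (tup x) < toLex (tup y) := by
  classical
  rw [Finsupp.Lex.lt_iff]
  refine ⟨y i₀, fun v hv => ?_, ?_⟩
  · change tup x v = tup y v
    rw [tup_apply, tup_apply]
    congr 1
    ext i
    simp only [Finset.mem_filter, Finset.mem_univ, true_and]
    rcases lt_or_ge i i₀ with hi | hi
    · rw [h1 i hi]
    · exact ⟨fun h => absurd (h2 i hi) (by rw [h]; exact hv.not_gt),
        fun h => absurd (h3 i hi) (by rw [h]; exact hv.not_ge)⟩
  · change tup x (y i₀) < tup y (y i₀)
    rw [tup_apply, tup_apply]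
    refine Finset.card_lt_card ⟨fun i hi => ?_, fun hsub => ?_⟩
    · simp only [Finset.mem_filter, Finset.mem_univ, true_and] at hi ⊢
      rcases lt_or_ge i i₀ with h | h
      · rw [← h1 i h, hi]
      · exact absurd (h2 i h) (by rw [hi]; exact lt_irrefl _)
    · have := @hsub i₀ (by simp)
      simp only [Finset.mem_filter, Finset.mem_univ, true_and] at this
      exact absurd (h2 i₀ le_rfl) (by rw [this]; exact lt_irrefl _)

end Tuples

/-! ### A weight that favours generators with large index -/

/-- The weight `1 + |n| + min |n| B` of the generator with index `n`. -/
def phi (B : ℕ) (n : ℤ) : ℕ := 1 + n.natAbs + min n.natAbs B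

theorem one_le_phi (B : ℕ) (n : ℤ) : 1 ≤ phi B n := by unfold phi; omega

theorem phi_add_lt (B : ℕ) (i j : ℤ) : phi B (i + j) < phi B i + phi B j := by
  unfold phi; omega

theorem natAbs_lt_phi (B : ℕ) (n : ℤ) : n.natAbs < phi B n := by unfold phi; omega

theorem phi_eq {B : ℕ} {ε z : ℤ} (hε : ε = 1 ∨ ε = -1) (hz : (B : ℤ) ≤ ε * z) :
    (phi B z : ℤ) = 1 + ε * z + B := by
  unfold phi
  rcases hε with rfl | rfl <;> omega

theorem phi_le (B : ℕ) (z : ℤ) : (phi B z : ℤ) ≤ 1 + |z| + B := by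
  unfold phi; rw [Int.abs_eq_natAbs]; omega

theorem phi_le' (B : ℕ) (z : ℤ) : (phi B z : ℤ) ≤ 1 + |z| + |z| := by
  unfold phi; rw [Int.abs_eq_natAbs]; omega

theorem abs_eq_mul_of_nonneg {ε z : ℤ} (hε : ε = 1 ∨ ε = -1) (hz : 0 ≤ ε * z) : |z| = ε * z := by
  rcases hε with rfl | rfl
  · rw [one_mul] at hz ⊢; exact abs_of_nonneg hz
  · rw [neg_one_mul] at hz ⊢; exact abs_of_nonpos (by omega)

namespace IsWittLike

section Words

variable {I : Set ℤ} {B N d d' : ℕ} {ε : ℤ} {κ x : Fin d → I} {k s : Fin d' → I}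
  {g : Fin d → Fin d'}

theorem mwt_lt_of_not_bijective (hε : ε = 1 ∨ ε = -1) (hB : 3 * d * N < B) (hd : d' ≤ d)
    (hκ : ∀ i, |(κ i : ℤ)| ≤ N) (hk : ∀ j, |(k j : ℤ)| ≤ N) (hx : ∀ i, (B : ℤ) ≤ ε * x i)
    (hs : ∀ j, (s j : ℤ) = k j + fiberSum (fun i => (x i : ℤ) - κ i) g j)
    (hg : ¬ Function.Bijective g) :
    mwt (fun i : I => phi B i) (tup s) < mwt (fun i : I => phi B i) (tup x) := by
  classical
  set n : Fin d → ℤ := fun i => (x i : ℤ) - κ i with hn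
  have him : (Finset.univ.image g).card < d := by
    refine lt_of_le_of_ne (Finset.card_image_le.trans (by simp)) fun h => hg ?_
    have h1 : Function.Injective g := by
      rw [← Set.injOn_univ, ← Finset.coe_univ]
      exact Finset.card_image_iff.1 (by simpa using h)
    have h2 : d = d' := le_antisymm (by simpa using Fintype.card_le_of_injective g h1) hd
    exact (Fintype.bijective_iff_injective_and_card g).2 ⟨h1, by simpa using h2⟩
  rw [mwt_tup, mwt_tup, ← Int.ofNat_lt]
  push_cast
  have h1 : ∀ j, (phi B (s j) : ℤ) ≤ (1 + 2 * N) + (∑ i, if g i = j then |n i| else 0) +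
      (if j ∈ Finset.univ.image g then (B : ℤ) else 0) := by
    intro j
    by_cases hj : j ∈ Finset.univ.image g
    · rw [if_pos hj]
      have h2 := phi_le B (s j)
      have h3 : |fiberSum n g j| ≤ ∑ i, if g i = j then |n i| else 0 := by
        refine (Finset.abs_sum_le_sum_abs _ _).trans (Finset.sum_le_sum fun i _ => ?_)
        split_ifs <;> simp
      have h4 : |(s j : ℤ)| ≤ |(k j : ℤ)| + |fiberSum n g j| := by
        rw [hs]; exact abs_add_le _ _
      have := hk j
      omega
    · rw [if_neg hj]
      have h2 : ∀ i, g i ≠ j := fun i hi => hj (by simpa using ⟨i, hi⟩)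
      have h3 := hs j
      rw [fiberSum_eq_zero h2, add_zero] at h3
      have h4 := phi_le' B (s j)
      have h5 : 0 ≤ ∑ i, if g i = j then |n i| else 0 :=
        Finset.sum_nonneg fun i _ => by split_ifs <;> simp
      have := hk j
      rw [h3] at h4 ⊢
      omega
  have h2 : ∀ i, (1 - N + B : ℤ) + |n i| ≤ phi B (x i) := by
    intro i
    rw [phi_eq hε (hx i), ← abs_eq_mul_of_nonneg hε ((Int.natCast_nonneg B).trans (hx i))]
    have h3 : |n i| ≤ |(x i : ℤ)| + |(κ i : ℤ)| := abs_sub _ _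
    have := hκ i
    omega
  refine (Finset.sum_le_sum fun j _ => h1 j).trans_lt
    (lt_of_lt_of_le ?_ (Finset.sum_le_sum fun i _ => h2 i))
  have h3 : ∑ j : Fin d', ∑ i, (if g i = j then |n i| else 0) = ∑ i, |n i| := by
    rw [Finset.sum_comm]; simp
  simp only [Finset.sum_add_distrib, h3, Finset.sum_sub_distrib, Finset.sum_const, Finset.card_univ,
    Fintype.card_fin, nsmul_eq_mul]
  rw [← Finset.sum_filter]
  simp only [Finset.sum_const, nsmul_eq_mul, Finset.filter_univ_mem]
  have h4 : ((Finset.univ.image g).card : ℤ) * B ≤ (d - 1) * B :=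
    mul_le_mul_of_nonneg_right (by omega) (by omega)
  have h5 : (d' : ℤ) * (1 + 2 * N) ≤ d * (1 + 2 * N) :=
    mul_le_mul_of_nonneg_right (by omega) (by omega)
  have h6 : (3 * d * N : ℤ) < B := by exact_mod_cast hB
  linarith

theorem mwt_tup_of_bijective (hε : ε = 1 ∨ ε = -1)
    (hκ : ∀ i, |(κ i : ℤ)| ≤ N) (hk : ∀ j, |(k j : ℤ)| ≤ N) (hx : ∀ i, (B : ℤ) + 2 * N ≤ ε * x i)
    (hs : ∀ j, (s j : ℤ) = k j + fiberSum (fun i => (x i : ℤ) - κ i) g j)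
    (hg : Function.Bijective g) :
    (mwt (fun i : I => phi B i) (tup s) : ℤ) - ε * ∑ j, (k j : ℤ) =
      mwt (fun i : I => phi B i) (tup x) - ε * ∑ i, (κ i : ℤ) := by
  have h1 : ∀ i, (s (g i) : ℤ) = k (g i) + (x i - κ i) := fun i => by
    rw [hs, fiberSum_apply hg.1]
  rw [← tup_comp s hg, mwt_tup, mwt_tup, ← hg.sum_comp fun j => (k j : ℤ)]
  push_cast
  rw [Finset.mul_sum, Finset.mul_sum, ← Finset.sum_sub_distrib, ← Finset.sum_sub_distrib]
  refine Finset.sum_congr rfl fun i _ => ?_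
  have h2 := abs_le.1 (hκ i)
  have h3 := abs_le.1 (hk (g i))
  have h4 := hx i
  have h5 : (B : ℤ) ≤ ε * s (g i) := by
    rw [h1]
    rcases hε with rfl | rfl <;> omega
  rw [phi_eq hε h5, phi_eq hε (by omega), h1]
  ring

theorem tup_lt_tup_of_lex (hκ : ∀ i, |(κ i : ℤ)| ≤ N) (hk : ∀ j, |(k j : ℤ)| ≤ N)
    (hx : ∀ i j, i < j → (x i : ℤ) + 4 * N < x j)
    (hs : ∀ j, (s j : ℤ) = k j + fiberSum (fun i => (x i : ℤ) - κ i) g j)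
    (hg : Function.Bijective g) (hlt : toLex (fun i => k (g i)) < toLex κ) :
    toLex (tup x) < toLex (tup s) := by
  have h1 : ∀ i, (s (g i) : ℤ) = k (g i) + (x i - κ i) := fun i => by
    rw [hs, fiberSum_apply hg.1]
  rw [← tup_comp s hg]
  obtain ⟨i₀, h2, h3⟩ := hlt
  have h3' : (k (g i₀) : ℤ) < κ i₀ := h3
  have hi : ∀ i, i₀ ≤ i → (i = i₀ ∨ (x i₀ : ℤ) + 4 * N < x i) := fun i hi => by
    rcases hi.eq_or_lt with rfl | hi
    · exact Or.inl rfl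
    · exact Or.inr (hx _ _ hi)
  refine tup_lt_tup i₀ (fun i hi => ?_) (fun i hi' => ?_) (fun i hi' => ?_)
  · have h4 : k (g i) = κ i := h2 i hi
    ext
    rw [h1, h4]; ring
  · rw [← Subtype.coe_lt_coe, h1]
    have := abs_le.1 (hκ i₀)
    have := abs_le.1 (hk (g i₀))
    rcases hi i hi' with rfl | h <;> omega
  · rw [← Subtype.coe_le_coe, h1, h1]
    have := abs_le.1 (hκ i₀)
    have := abs_le.1 (hk (g i₀))
    have := abs_le.1 (hκ i)
    have := abs_le.1 (hk (g i))
    rcases hi i hi' with rfl | h <;> omega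

end Words

end IsWittLike

namespace IsWittLike

variable {C R : Type*} [CommRing C] [Ring R] [Algebra C R] {I : Set ℤ} {e : ℤ → R}

variable (C) in
/-- The span of the monomials that precede the monomial `m`: those of lower weight, and those of
the same weight that are lexicographically larger. -/
def preceding (e : ℤ → R) (B : ℕ) (m : I →₀ ℕ) : Submodule C R :=
  Submodule.span C {y | ∃ m' : I →₀ ℕ,
    mwt (fun i : I => phi B i) m' = mwt (fun i : I => phi B i) m ∧
    toLex m < toLex m' ∧ mon (gens I e) m' = y} ⊔
  Fil C (gens I e) (fun i : I => phi B i) (mwt (fun i : I => phi B i) m)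

theorem commLower_phi (h : IsWittLike C I e) (B : ℕ) :
    CommLower C (gens I e) fun i : I => phi B i :=
  h.commLower (phi B) (one_le_phi B) (phi_add_lt B)

section Reduction

variable {B N d : ℕ} {ε : ℤ} {κ x : Fin d → I}

theorem exists_reduction (h : IsWittLike C I e) (hε : ε = 1 ∨ ε = -1)
    (hI : ∀ x, 0 < ε * x → x ∈ I) (hB : 3 * d * N < B) (hκ : ∀ i, |(κ i : ℤ)| ≤ N)
    (hx : ∀ i, (B : ℤ) + 2 * N ≤ ε * x i) (hx' : ∀ i j, i < j → (x i : ℤ) + 4 * N < x j) :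
    ∃ D : R →ₗ[C] R, ∀ (d' : ℕ) (k : Fin d' → I), d' ≤ d → (∀ j, |(k j : ℤ)| ≤ N) →
      (∀ g : Fin d → Fin d', Function.Bijective g → ε * ∑ j, (k j : ℤ) ≤ ε * ∑ i, (κ i : ℤ) ∧
        (ε * ∑ j, (k j : ℤ) = ε * ∑ i, (κ i : ℤ) → toLex (fun i => k (g i)) ≤ toLex κ)) →
      ∃ a : ℕ, (tup k ≠ tup κ → a = 0) ∧ (tup k = tup κ → a ≠ 0) ∧
        D (word (gens I e) (List.ofFn k)) -
          (a : C) • (∏ i, ((κ i - (x i - κ i) : ℤ) : C)) • mon (gens I e) (tup x) ∈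
            preceding C e B (tup x) := by
  classical
  set n : Fin d → ℤ := fun i => (x i : ℤ) - κ i with hn
  have hn1 : ∀ i, (B : ℤ) + N ≤ ε * n i := fun i => by
    have h1 := hx i
    have h2 := abs_le.1 (hκ i)
    rw [hn]
    rcases hε with rfl | rfl <;> simp only <;> omega
  have hn0 : ∀ i, 0 < ε * n i := fun i => by have := hn1 i; omega
  obtain ⟨D, hD⟩ := h.exists_iterated_commutator hI d n hn0
  refine ⟨D, fun d' k hd hk hmax => ?_⟩
  have hnk : ∀ i j, 0 < ε * (n i + k j) := fun i j => by
    have h1 := hn1 i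
    have h2 := abs_le.1 (hk j)
    rcases hε with rfl | rfl <;> omega
  obtain ⟨c, hc, hc'⟩ := hD d' (fun j => k j) (fun j => (k j).2) hnk
  have hmem := add_fiberSum_mem (ε := ε) hI hn0 (fun j => (k j).2) hnk
  let s : (Fin d → Fin d') → Fin d' → I := fun g j => ⟨_, hmem g j⟩
  have hs : ∀ g j, (s g j : ℤ) = k j + fiberSum n g j := fun g j => rfl
  let G : Finset (Fin d → Fin d') :=
    Finset.univ.filter fun g => Function.Bijective g ∧ (fun i => k (g i)) = κ
  have hx0 : ∀ i, (B : ℤ) ≤ ε * x i := fun i => by have := hx i; omega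
  have hcomm := h.commLower_phi B
  refine ⟨G.card, fun hne => ?_, fun heq => ?_, ?_⟩
  · rw [Finset.card_eq_zero, Finset.filter_eq_empty_iff]
    rintro g - ⟨hg, hg'⟩
    exact hne (by rw [← hg', tup_comp k hg])
  · obtain ⟨g, hg⟩ := exists_equiv_of_tup_eq heq
    exact Finset.card_ne_zero_of_mem (a := g)
      (Finset.mem_filter.2 ⟨Finset.mem_univ _, g.bijective, funext hg⟩)
  · have h1 : D (word (gens I e) (List.ofFn k)) = ∑ g, c g • word (gens I e) (List.ofFn (s g)) := by
      simp only [word, List.map_ofFn]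
      exact hc'
    have h2 : (G.card : C) • (∏ i, ((κ i - (x i - κ i) : ℤ) : C)) • mon (gens I e) (tup x) =
        ∑ g, if Function.Bijective g ∧ (fun i => k (g i)) = κ then
          (∏ i, ((κ i - (x i - κ i) : ℤ) : C)) • mon (gens I e) (tup x) else 0 := by
      rw [← Finset.sum_filter, Finset.sum_const, Nat.cast_smul_eq_nsmul]
    rw [h1, h2, ← Finset.sum_sub_distrib]
    refine Submodule.sum_mem _ fun g _ => ?_
    by_cases hg : Function.Bijective g
    · obtain ⟨hle, hlex⟩ := hmax g hg
      have hw := mwt_tup_of_bijective (g := g) (s := s g) hε hκ hk hx (hs g) hg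
      rcases hle.lt_or_eq with hlt | heq
      · rw [if_neg, sub_zero]
        · refine Submodule.smul_mem _ _ (Submodule.mem_sup_right (word_mem_Fil ?_))
          rw [wt_eq_mwt _ (toMultiset_tup (s g)).symm]
          omega
        · rintro ⟨-, hg'⟩
          have : ∑ j, (k j : ℤ) = ∑ i, (κ i : ℤ) := by
            rw [← hg.sum_comp, ← hg']
          rw [this] at hlt
          exact lt_irrefl _ hlt
      · have hw' : mwt (fun i : I => phi B i) (tup (s g)) = mwt (fun i : I => phi B i) (tup x) := by
          omega
        have h3 := hcomm.word_sub_mon (toMultiset_tup (s g)).symm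
        rw [hw'] at h3
        have h4 : word (gens I e) (List.ofFn (s g)) - mon (gens I e) (tup (s g)) ∈
          preceding C e B (tup x) := Submodule.mem_sup_right h3
        by_cases hg' : (fun i => k (g i)) = κ
        · rw [if_pos ⟨hg, hg'⟩, hc g hg.1]
          have h5 : tup (s g) = tup x := by
            rw [← tup_comp _ hg]
            congr 1
            ext i
            have h6 : k (g i) = κ i := congrFun hg' i
            rw [hs, fiberSum_apply hg.1, h6, hn]
            ring
          have h6 : ∀ i, k (g i) = κ i := fun i => congrFun hg' i
          simp only [h6]
          rw [← smul_sub, ← h5]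
          rw [h5]
          rw [h5] at h4
          exact Submodule.smul_mem _ _ h4
        · rw [if_neg (fun hh => hg' hh.2), sub_zero]
          refine Submodule.smul_mem _ _ ?_
          have h5 := tup_lt_tup_of_lex (g := g) (s := s g) hκ hk hx' (hs g) hg
            (lt_of_le_of_ne (hlex heq) fun hh => hg' (toLex.injective hh))
          have h6 : mon (gens I e) (tup (s g)) ∈ preceding C e B (tup x) :=
            Submodule.mem_sup_left (Submodule.subset_span ⟨_, hw', h5, rfl⟩)
          simpa using Submodule.add_mem _ h4 h6
    · rw [if_neg (fun hh => hg hh.1), sub_zero]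
      refine Submodule.smul_mem _ _ (Submodule.mem_sup_right (word_mem_Fil ?_))
      rw [wt_eq_mwt _ (toMultiset_tup (s g)).symm]
      exact mwt_lt_of_not_bijective hε hB hd hκ hk hx0 (hs g) hg

end Reduction

theorem exists_index_bound (P : MvPolynomial I C) :
    ∃ N : ℕ, ∀ m ∈ P.support, ∀ i : I, m i ≠ 0 → |(i : ℤ)| ≤ N := by
  classical
  refine ⟨P.support.sup fun m => m.support.sup fun i => (i : ℤ).natAbs, fun m hm i hi => ?_⟩
  rw [Int.abs_eq_natAbs]
  refine Int.ofNat_le.2 (le_trans ?_ (Finset.le_sup hm))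
  exact Finset.le_sup (f := fun i : I => (i : ℤ).natAbs) (Finsupp.mem_support_iff.2 hi)

theorem tup_apply_ne_zero {ι : Type*} {d : ℕ} (k : Fin d → ι) (j : Fin d) : tup k (k j) ≠ 0 := by
  classical
  rw [tup_apply]
  exact Finset.card_ne_zero_of_mem (a := j) (by simp)

/-- A linear relation between the monomials makes the monomials with large gaps reducible. -/
theorem mon_tup_mem_preceding {L : Type*} [Field L] [CharZero L] [Algebra L R]
    (h : IsWittLike L I e) {P : MvPolynomial I L} (hP : P ≠ 0) (hP0 : quant L (gens I e) P = 0)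
    {d N B : ℕ} (hd : P.totalDegree = d) (hN : ∀ m ∈ P.support, ∀ i : I, m i ≠ 0 → |(i : ℤ)| ≤ N)
    (hB : 3 * d * N < B) {ε : ℤ} (hε : ε = 1 ∨ ε = -1)
    (hI : ∀ x, 0 < ε * x → x ∈ I) (x : Fin d → I)
    (hx : ∀ i, (B : ℤ) + 2 * N ≤ ε * x i) (hx' : ∀ i j, i < j → (x i : ℤ) + 4 * N < x j) :
    mon (gens I e) (tup x) ∈ preceding L e B (tup x) := by
  classical
  have hbd : ∀ {d' : ℕ} (k : Fin d' → I), tup k ∈ P.support → ∀ j, |(k j : ℤ)| ≤ N :=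
    fun k hk j => hN _ hk _ (tup_apply_ne_zero k j)
  let A : Set (Fin d → I) := {κ | tup κ ∈ P.support}
  have hA : A.Finite := by
    refine (Set.Finite.pi' (t := fun _ : Fin d => {i : I | |(i : ℤ)| ≤ N}) fun _ => ?_).subset
      fun κ hκ i => hbd κ hκ i
    refine Set.Finite.of_finite_image (f := fun i : I => (i : ℤ)) ?_
      (Subtype.val_injective.injOn)
    refine (Set.finite_Icc (-(N : ℤ)) N).subset ?_
    rintro _ ⟨i, hi, rfl⟩
    exact abs_le.1 hi
  have hne : A.Nonempty := by
    obtain ⟨m, hm, hm'⟩ := exists_degree_eq_totalDegree hP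
    obtain ⟨d', k, rfl, -⟩ := exists_tup_eq (gens I e) m
    rw [degree_tup, hd] at hm'
    subst hm'
    exact ⟨k, hm⟩
  obtain ⟨κ, hκA, hκ⟩ := A.exists_max_image
    (fun κ => toLex (ε * ∑ i, (κ i : ℤ), toLex κ)) hA hne
  obtain ⟨D, hD⟩ := h.exists_reduction hε hI hB (hbd κ hκA) hx hx'
  have key : ∀ m ∈ P.support, ∃ a : ℕ, (m ≠ tup κ → a = 0) ∧ (m = tup κ → a ≠ 0) ∧
      D (mon (gens I e) m) -
        (a : L) • (∏ i, ((κ i - (x i - κ i) : ℤ) : L)) • mon (gens I e) (tup x) ∈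
          preceding L e B (tup x) := by
    intro m hm
    obtain ⟨d', k, rfl, hk⟩ := exists_tup_eq (gens I e) m
    rw [hk]
    refine hD d' k ?_ (hbd k hm) fun g hg => ?_
    · rw [← degree_tup k, ← hd]; exact degree_le_totalDegree hm
    · have h1 := hκ (fun i => k (g i))
        (show tup (fun i => k (g i)) ∈ P.support by rwa [tup_comp k hg])
      rw [hg.sum_comp fun j => (k j : ℤ)] at h1
      rcases Prod.Lex.le_iff.1 h1 with h2 | h2
      · exact ⟨h2.le, fun h3 => absurd h3 h2.ne⟩
      · exact ⟨h2.1.le, fun _ => h2.2⟩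
  choose! a ha0 ha1 ha using key
  have h1 : ∑ m ∈ P.support, coeff m P • (D (mon (gens I e) m) -
      (a m : L) • (∏ i, ((κ i - (x i - κ i) : ℤ) : L)) • mon (gens I e) (tup x)) ∈
        preceding L e B (tup x) :=
    Submodule.sum_mem _ fun m hm => Submodule.smul_mem _ _ (ha m hm)
  have h2 : ∑ m ∈ P.support, coeff m P • D (mon (gens I e) m) = 0 := by
    rw [quant_eq_sum] at hP0
    simpa using congrArg D hP0
  simp only [smul_sub, Finset.sum_sub_distrib, h2, zero_sub] at h1
  rw [Submodule.neg_mem_iff, Finset.sum_eq_single (tup κ), smul_smul, smul_smul] at h1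
  · refine (Submodule.smul_mem_iff _ ?_).1 h1
    refine mul_ne_zero (mul_ne_zero (mem_support_iff.1 hκA) ?_) ?_
    · exact_mod_cast ha1 _ hκA rfl
    · refine Finset.prod_ne_zero_iff.2 fun i _ => Int.cast_ne_zero.2 fun h0 => ?_
      have h3 := abs_le.1 (hbd κ hκA i)
      have h4 := hx i
      rcases hε with rfl | rfl <;> omega
  · intro m hm hne
    rw [ha0 m hm hne]; simp
  · exact fun hn => absurd hκA hn

end IsWittLike

/-! ### Counting monomials -/

/-- A finite set of integers contains a sequence of `d` elements with gaps larger than `c`, or it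
has few elements. -/
theorem exists_chain_or_card_le (c d : ℕ) (A : Finset ℤ) :
    (∃ x : Fin d → ℤ, (∀ i, x i ∈ A) ∧ ∀ i j, i < j → x i + c < x j) ∨ A.card ≤ d * (c + 1) := by
  induction d generalizing A with
  | zero => exact Or.inl ⟨Fin.elim0, fun i => i.elim0, fun i => i.elim0⟩
  | succ d ih =>
    rcases A.eq_empty_or_nonempty with rfl | hA
    · right; simp
    · set a := A.min' hA with ha
      rcases ih (A.filter fun z => a + c < z) with ⟨x, hx, hx'⟩ | h
      · left
        refine ⟨Fin.cons a x, fun i => ?_, fun i j hij => ?_⟩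
        · refine Fin.cases ?_ (fun i => ?_) i
          · exact A.min'_mem hA
          · exact (Finset.mem_filter.1 (hx i)).1
        · induction j using Fin.cases with
          | zero => exact absurd hij (Fin.not_lt_zero i)
          | succ j =>
            induction i using Fin.cases with
            | zero => exact (Finset.mem_filter.1 (hx j)).2
            | succ i => exact hx' i j (Fin.succ_lt_succ_iff.1 hij)
      · right
        have h1 : A ⊆ A.filter (fun z => a + c < z) ∪ Finset.Icc a (a + c) := fun z hz => by
          have := A.min'_le z hz
          simp only [Finset.mem_union, Finset.mem_filter, Finset.mem_Icc]
          by_cases h : a + c < z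
          · exact Or.inl ⟨hz, h⟩
          · exact Or.inr ⟨this, by omega⟩
        have h2 := (Finset.card_le_card h1).trans (Finset.card_union_le _ _)
        rw [Int.card_Icc, show a + c + 1 - a = ((c + 1 : ℕ) : ℤ) by push_cast; ring,
          Int.toNat_natCast] at h2
        rw [add_mul, one_mul]
        omega

theorem mwt_eq_sum {ι : Type*} (w : ι → ℕ) (m : ι →₀ ℕ) : mwt w m = m.sum fun i n => n * w i := by
  induction m using Finsupp.induction_linear with
  | zero => simp
  | add f g hf hg =>
    rw [mwt_add, hf, hg, Finsupp.sum_add_index'] <;> intros <;> simp [add_mul]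
  | single i n => simp

theorem mul_le_mwt {ι : Type*} (w : ι → ℕ) (m : ι →₀ ℕ) (i : ι) : m i * w i ≤ mwt w m := by
  by_cases hi : m i = 0
  · simp [hi]
  · rw [mwt_eq_sum]
    exact Finset.single_le_sum (f := fun i => m i * w i) (fun _ _ => Nat.zero_le _)
      (Finsupp.mem_support_iff.2 hi)

theorem card_support_le_mwt {ι : Type*} {w : ι → ℕ} (hw : ∀ i, 1 ≤ w i) (m : ι →₀ ℕ) :
    m.support.card ≤ mwt w m := by
  rw [mwt_eq_sum, Finset.card_eq_sum_ones]
  refine Finset.sum_le_sum fun i hi => ?_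
  have h1 : m i ≠ 0 := Finsupp.mem_support_iff.1 hi
  exact Nat.mul_pos (Nat.pos_of_ne_zero h1) (hw i)

section Decode

variable (I : Set ℤ)

/-- The monomial with exponent `(f t).2` at the index `(f t).1`. -/
def decode {p : ℕ} (f : Fin p → ℤ × ℕ) : I →₀ ℕ := by
  classical
  exact ∑ t, if h : (f t).1 ∈ I then Finsupp.single ⟨(f t).1, h⟩ (f t).2 else 0

/-- Codes for the monomials with at most `p` factors, indices and exponents bounded by `s`. -/
def codes (p s : ℕ) : Finset (Fin p → ℤ × ℕ) :=
  Fintype.piFinset fun _ => Finset.Icc (-(s : ℤ)) s ×ˢ Finset.range (s + 1)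

theorem card_codes (p s : ℕ) : (codes p s).card = ((2 * s + 1) * (s + 1)) ^ p := by
  rw [codes, Fintype.card_piFinset_const, Finset.card_product, Int.card_Icc, Finset.card_range]
  congr 2
  omega

variable {I}

theorem exists_decode_eq (p s : ℕ) (m : I →₀ ℕ) (hp : m.support.card ≤ p)
    (hs : ∀ i, m i ≠ 0 → |(i : ℤ)| ≤ s ∧ m i ≤ s) : ∃ f ∈ codes p s, decode I f = m := by
  classical
  induction p generalizing m with
  | zero =>
    have : m = 0 := by simpa using hp
    exact ⟨Fin.elim0, by
      rw [codes, Fintype.mem_piFinset]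
      exact fun t => t.elim0, by simp [decode, this]⟩
  | succ p ih =>
    by_cases hm : m = 0
    · refine ⟨fun _ => (0, 0), by simp [codes, Fintype.mem_piFinset], ?_⟩
      rw [hm, decode]
      exact Finset.sum_eq_zero fun t _ => by split_ifs <;> simp
    · obtain ⟨i, hi⟩ := Finsupp.support_nonempty_iff.2 hm
      have hi' := Finsupp.mem_support_iff.1 hi
      obtain ⟨f, hf, hf'⟩ := ih (m.erase i) (by
        rw [Finsupp.support_erase, Finset.card_erase_of_mem hi]; omega) (fun j hj => by
          rw [Finsupp.erase_apply] at hj ⊢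
          split_ifs at hj ⊢ with h
          · simp at hj
          · exact hs j hj)
      obtain ⟨h1, h2⟩ := hs i hi'
      refine ⟨Fin.cons ((i : ℤ), m i) f, ?_, ?_⟩
      · rw [codes, Fintype.mem_piFinset] at hf ⊢
        refine Fin.cases ?_ (fun t => ?_)
        · have := abs_le.1 h1
          simp only [Fin.cons_zero, Finset.mem_product, Finset.mem_Icc, Finset.mem_range]
          omega
        · exact hf t
      · rw [decode, Fin.sum_univ_succ]
        simp only [Fin.cons_zero, Fin.cons_succ, Subtype.coe_prop, dite_true, Subtype.coe_eta]
        conv_rhs => rw [← Finsupp.single_add_erase i m, ← hf', decode]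

end Decode

/-- The algebra `S` has an exhaustive filtration by subspaces of polynomially bounded dimension. -/
def HasPolynomialGrowth (L S : Type*) [Field L] [Ring S] [Algebra L S] : Prop :=
  ∃ (p : ℕ) (F : ℕ → Submodule L S), Monotone F ∧
    (∀ a b x y, x ∈ F a → y ∈ F b → x * y ∈ F (a + b)) ∧ 1 ∈ F 0 ∧ (∀ x, ∃ s, x ∈ F s) ∧
    ∀ s, FiniteDimensional L (F s) ∧ Module.finrank L (F s) ≤ ((2 * s + 3) * (s + 2)) ^ p

namespace IsWittLike

variable {R L : Type*} [Field L] [CharZero L] [Ring R] [Algebra L R] {I : Set ℤ} {e : ℤ → R}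

theorem bounds_of_mwt_le {B s : ℕ} {m : I →₀ ℕ} (hm : mwt (fun i : I => phi B i) m ≤ s) (i : I)
    (hi : m i ≠ 0) : |(i : ℤ)| ≤ s ∧ m i ≤ s := by
  have h1 := mul_le_mwt (fun i : I => phi B i) m i
  have h2 := natAbs_lt_phi B i
  have h3 := one_le_phi B i
  have h4 : phi B i ≤ m i * phi B i := Nat.le_mul_of_pos_left _ (Nat.pos_of_ne_zero hi)
  have h5 : m i ≤ m i * phi B i := Nat.le_mul_of_pos_right _ h3
  rw [Int.abs_eq_natAbs]
  omega

theorem finite_mwt_le (B s : ℕ) : {m : I →₀ ℕ | mwt (fun i : I => phi B i) m ≤ s}.Finite := by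
  refine ((codes s s).finite_toSet.image (decode I)).subset fun m hm => ?_
  obtain ⟨f, hf, hf'⟩ := exists_decode_eq s s m
    ((card_support_le_mwt (fun i : I => one_le_phi B i) m).trans hm) (bounds_of_mwt_le hm)
  exact ⟨f, hf, hf'⟩

/-- A linear relation between the monomials makes all monomials with large gaps reducible. -/
theorem exists_reducible (h : IsWittLike L I e) {P : MvPolynomial I L} (hP : P ≠ 0)
    (hP0 : quant L (gens I e) P = 0) : ∃ B d c K : ℕ, ∀ x : Fin d → I,
      (∀ i j, i < j → (x i : ℤ) + c < x j) → ((∀ i, (K : ℤ) < x i) ∨ ∀ i, (x i : ℤ) < -K) →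
        mon (gens I e) (tup x) ∈ preceding L e B (tup x) := by
  obtain ⟨N, hN⟩ := exists_index_bound P
  obtain ⟨a, ha⟩ : ∃ a : ℕ, I = Set.univ ∨ ∀ i ∈ I, -(a : ℤ) < i := by
    by_cases hI : I = Set.univ
    · exact ⟨0, Or.inl hI⟩
    · obtain ⟨a, ha⟩ := (Set.ne_univ_iff_exists_notMem I).1 hI
      refine ⟨a.natAbs, Or.inr fun i hi => ?_⟩
      by_contra hlt
      exact ha (h.upper (show i ≤ a by omega) hi)
  have hpos : ∀ x, 0 < 1 * x → x ∈ I := fun x hx => h.upper (show 1 ≤ x by omega) h.one_mem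
  obtain ⟨d, hd⟩ : ∃ d, P.totalDegree = d := ⟨_, rfl⟩
  refine ⟨3 * d * N + 1, d, 4 * N, 3 * d * N + 1 + 2 * N + a, fun x hx hx' => ?_⟩
  push_cast at hx hx'
  rcases hx' with hx' | hx'
  · refine h.mon_tup_mem_preceding hP hP0 hd hN (Nat.lt_succ_self _) (Or.inl rfl) hpos x
      (fun i => ?_) hx
    have := hx' i
    push_cast
    omega
  · rcases ha with rfl | ha
    · refine h.mon_tup_mem_preceding hP hP0 hd hN (Nat.lt_succ_self _) (Or.inr rfl)
        (fun _ _ => trivial) x (fun i => ?_) hx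
      have := hx' i
      push_cast
      omega
    · refine h.mon_tup_mem_preceding hP hP0 hd hN (Nat.lt_succ_self _) (Or.inl rfl) hpos x
        (fun i => ?_) hx
      have h1 := hx' i
      have h2 := ha _ (x i).2
      have h3 : (0 : ℤ) ≤ 3 * d * N := by positivity
      omega

theorem tup_le_of_injective {d : ℕ} {x : Fin d → I} (hx : Function.Injective x) {m : I →₀ ℕ}
    (hm : ∀ i, m (x i) ≠ 0) : tup x ≤ m := by
  classical
  intro v
  rw [tup_apply]
  by_cases hv : ∃ i, x i = v
  · obtain ⟨i, rfl⟩ := hv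
    have h1 : (Finset.univ.filter fun j => x j = x i) = {i} := by
      ext j; simp [hx.eq_iff]
    rw [h1, Finset.card_singleton]
    exact Nat.one_le_iff_ne_zero.2 (hm i)
  · rw [Finset.filter_eq_empty_iff.2 fun i _ hi => hv ⟨i, hi⟩, Finset.card_empty]
    exact Nat.zero_le _

theorem exists_chain_of_card_support {c d K : ℕ} (m : I →₀ ℕ)
    (hm : 2 * (d * (c + 1)) + (2 * K + 1) < m.support.card) :
    ∃ x : Fin d → I, (∀ i, m (x i) ≠ 0) ∧ (∀ i j, i < j → (x i : ℤ) + c < x j) ∧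
      ((∀ i, (K : ℤ) < x i) ∨ ∀ i, (x i : ℤ) < -K) := by
  classical
  let A : Finset ℤ := m.support.image fun i : I => (i : ℤ)
  have hA : A.card = m.support.card := Finset.card_image_of_injective _ Subtype.val_injective
  have hmem : ∀ z ∈ A, ∃ i : I, m i ≠ 0 ∧ (i : ℤ) = z := fun z hz => by
    obtain ⟨i, hi, rfl⟩ := Finset.mem_image.1 hz
    exact ⟨i, Finsupp.mem_support_iff.1 hi, rfl⟩
  rcases exists_chain_or_card_le c d (A.filter fun z => (K : ℤ) < z) with ⟨x, hx, hx'⟩ | h1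
  · choose y hy hy' using fun i => hmem _ (Finset.mem_filter.1 (hx i)).1
    exact ⟨y, hy, fun i j hij => by rw [hy', hy']; exact hx' i j hij,
      Or.inl fun i => by rw [hy']; exact (Finset.mem_filter.1 (hx i)).2⟩
  · rcases exists_chain_or_card_le c d (A.filter fun z => z < -(K : ℤ)) with ⟨x, hx, hx'⟩ | h2
    · choose y hy hy' using fun i => hmem _ (Finset.mem_filter.1 (hx i)).1
      exact ⟨y, hy, fun i j hij => by rw [hy', hy']; exact hx' i j hij,
        Or.inr fun i => by rw [hy']; exact (Finset.mem_filter.1 (hx i)).2⟩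
    · exfalso
      have h3 : A ⊆ (A.filter (fun z => (K : ℤ) < z) ∪ A.filter fun z => z < -(K : ℤ)) ∪
          Finset.Icc (-(K : ℤ)) K := fun z hz => by
        simp only [Finset.mem_union, Finset.mem_filter, Finset.mem_Icc, hz, true_and]
        omega
      have h4 := (Finset.card_le_card h3).trans (Finset.card_union_le _ _)
      have h5 := Finset.card_union_le (A.filter fun z => (K : ℤ) < z)
        (A.filter fun z => z < -(K : ℤ))
      rw [Int.card_Icc] at h4
      omega

/-- A linear relation between the monomials forces polynomial growth. -/
theorem hasPolynomialGrowth (h : IsWittLike L I e)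
    (hq : ¬ Function.Injective (quant L (gens I e))) : HasPolynomialGrowth L R := by
  classical
  rw [injective_iff_map_eq_zero] at hq
  push Not at hq
  obtain ⟨P, hP0, hP⟩ := hq
  obtain ⟨B, d, c, K, hred⟩ := h.exists_reducible hP hP0
  set p := 2 * (d * (c + 1)) + (2 * K + 1) with hp
  have hc := h.commLower_phi B
  let w : I → ℕ := fun i => phi B i
  let Nor : ℕ → Submodule L R := fun s =>
    Submodule.span L {y | ∃ m : I →₀ ℕ, mwt w m < s ∧ m.support.card ≤ p ∧ mon (gens I e) m = y}
  have hNor : ∀ {s t : ℕ}, s ≤ t → Nor s ≤ Nor t := fun hst =>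
    Submodule.span_mono fun y ⟨m, hm, hm'⟩ => ⟨m, hm.trans_le hst, hm'⟩
  have key : ∀ s, Fil L (gens I e) w s ≤ Nor s := by
    intro s
    induction s with
    | zero => simp
    | succ s ih =>
      have hlow : Fil L (gens I e) w s ≤ Nor (s + 1) := ih.trans (hNor (Nat.le_succ s))
      have hmon : ∀ m : I →₀ ℕ, mwt w m = s → mon (gens I e) m ∈ Nor (s + 1) := by
        by_contra hbad
        push Not at hbad
        let Bad : Set (I →₀ ℕ) := {m | mwt w m = s ∧ mon (gens I e) m ∉ Nor (s + 1)}
        have hfin : Bad.Finite := (finite_mwt_le (I := I) B s).subset fun m hm => hm.1.le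
        obtain ⟨m, ⟨hm, hm'⟩, hmax⟩ := Bad.exists_max_image toLex hfin hbad
        by_cases hcard : m.support.card ≤ p
        · exact hm' (Submodule.subset_span ⟨m, by omega, hcard, rfl⟩)
        · obtain ⟨x, hx, hx', hx''⟩ := exists_chain_of_card_support m (not_le.1 hcard)
          have hinj : Function.Injective x := by
            intro i j hij
            by_contra hne
            rcases lt_or_gt_of_ne hne with hlt | hlt
            · have := hx' _ _ hlt; rw [hij] at this; omega
            · have := hx' _ _ hlt; rw [hij] at this; omega
          obtain ⟨u, rfl⟩ := exists_add_of_le (tup_le_of_injective hinj hx)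
          rw [add_comm (tup x) u] at hm hm' hmax
          rw [mwt_add] at hm
          have hwt : ∀ m', mwt w m' = mwt w (tup x) →
              mon (gens I e) u * mon (gens I e) m' - mon (gens I e) (u + m') ∈ Nor (s + 1) := by
            intro m' hm'
            have := hc.mon_mul_mon u m'
            rw [show (fun i : I => phi B i) = w from rfl, mwt_add, hm', hm] at this
            exact hlow this
          apply hm'
          have h1 : preceding L e B (tup x) ≤
              (Nor (s + 1)).comap (LinearMap.mulLeft L (mon (gens I e) u)) := by
            refine sup_le (Submodule.span_le.2 ?_) fun y hy => ?_
            · rintro _ ⟨m', hw', hlt, rfl⟩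
              change mon (gens I e) u * mon (gens I e) m' ∈ Nor (s + 1)
              have h2 : mon (gens I e) (u + m') ∈ Nor (s + 1) := by
                by_contra h3
                have h4 := hmax (u + m') ⟨by rw [mwt_add, ← hm]; congr 1, h3⟩
                have h5 : toLex (u + tup x) < toLex (u + m') :=
                  add_lt_add_right (α := Lex (I →₀ ℕ)) hlt (toLex u)
                exact absurd h4 h5.not_ge
              simpa using Submodule.add_mem _ (hwt m' hw') h2
            · change mon (gens I e) u * y ∈ Nor (s + 1)
              have h2 : mon (gens I e) u ∈ Fil L (gens I e) w (mwt w u + 1) :=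
                mon_mem_Fil (Nat.lt_succ_self _)
              have h3 := mul_mem_Fil h2 hy
              rw [show (fun i : I => phi B i) = w from rfl, hm] at h3
              exact hlow h3
          have h2 : mon (gens I e) u * mon (gens I e) (tup x) ∈ Nor (s + 1) :=
            h1 (hred x hx' hx'')
          simpa using Submodule.sub_mem _ h2 (hwt _ rfl)
      refine (hc.Fil_le_span (s + 1)).trans (Submodule.span_le.2 ?_)
      rintro _ ⟨m, hm, rfl⟩
      rcases (Nat.lt_succ_iff.1 hm).lt_or_eq with hlt | heq
      · exact hlow (mon_mem_Fil hlt)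
      · exact hmon m heq
  have hcount : ∀ s, Fil L (gens I e) w (s + 1) ≤ Submodule.span L
      ((((codes p s).image (decode I)).image (mon (gens I e)) : Finset R) : Set R) := fun s => by
    refine (key (s + 1)).trans (Submodule.span_mono ?_)
    rintro _ ⟨m, hm, hm', rfl⟩
    obtain ⟨f, hf, hf'⟩ := exists_decode_eq p s m hm' (bounds_of_mwt_le (Nat.lt_succ_iff.1 hm))
    simp only [Finset.coe_image, Set.mem_image, Finset.mem_coe]
    exact ⟨m, ⟨f, hf, hf'⟩, rfl⟩
  refine ⟨p, fun s => Fil L (gens I e) w (s + 1), fun s t hst => Fil_mono (by omega),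
    fun a b x y hx hy => ?_, ?_, fun x => ?_, fun s => ⟨?_, ?_⟩⟩
  · have := mul_mem_Fil hx hy
    rwa [← add_assoc] at this
  · exact word_mem_Fil (l := []) (by simp)
  · obtain ⟨s, hs⟩ := exists_mem_Fil (w := w) h.adjoin_gens x
    exact ⟨s, Fil_mono (Nat.le_succ s) hs⟩
  · have := FiniteDimensional.span_finset L
      (((codes p s).image (decode I)).image (mon (gens I e)))
    exact Submodule.finiteDimensional_of_le (hcount s)
  · have := FiniteDimensional.span_finset L
      (((codes p s).image (decode I)).image (mon (gens I e)))
    refine (Submodule.finrank_mono (hcount s)).trans ((finrank_span_finset_le_card _).trans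
      (Finset.card_image_le.trans (Finset.card_image_le.trans ?_)))
    rw [card_codes]
    exact Nat.pow_le_pow_left (Nat.mul_le_mul (by omega) (by omega)) p

end IsWittLike

/-! ### Ring homomorphisms to algebras of polynomial growth -/

theorem map_rat_smul_eq {A S L : Type*} [Ring A] [Algebra ℚ A] [Field L] [CharZero L] [Ring S]
    [Algebra L S] (f : A →+* S) (q : ℚ) (y : A) : f (q • y) = (q : L) • f y := by
  let _ : Module ℚ S := Module.compHom S (algebraMap ℚ L)
  have h : ∀ x : S, q • x = (q : L) • x := fun x => by
    change (algebraMap ℚ L q) • x = _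
    rw [eq_ratCast]
  rw [map_rat_smul f q y, h]

theorem word_map_mem {A S L : Type*} [Ring A] [Ring S] [Field L] [Algebra L S] {ι : Type*}
    (f : A →+* S) {e : ι → A} {F : ℕ → Submodule L S}
    (hmul : ∀ a b x y, x ∈ F a → y ∈ F b → x * y ∈ F (a + b)) (hone : 1 ∈ F 0) {s : ℕ}
    (l : List ι) (hl : ∀ i ∈ l, f (e i) ∈ F s) : f (word e l) ∈ F (l.length * s) := by
  induction l with
  | nil => simpa using hone
  | cons i l ih =>
    rw [word_cons, map_mul, List.length_cons, add_mul, one_mul, add_comm]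
    exact hmul _ _ _ _ (hl i (by simp)) (ih fun j hj => hl j (by simp [hj]))

namespace IsWittLike

variable {A S L : Type*} [Ring A] [Algebra ℚ A] [Field L] [CharZero L] [Ring S] [Algebra L S]
  {I : Set ℤ} {e : ℤ → A}

theorem eq_zero_of_sum_smul_map (h : IsWittLike ℚ I e)
    (hq : Function.Injective (quant ℚ (gens I e))) {f : A →+* S} (hf : Function.Injective f)
    {β : Type*} {b : β → L} (hb : LinearIndependent ℚ b) (s : Finset β) (y : β → A)
    (hy : ∑ i ∈ s, b i • f (y i) = 0) : ∀ i ∈ s, y i = 0 := by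
  classical
  induction s using Finset.induction_on generalizing y with
  | empty => simp
  | insert i₀ s hi₀ ih =>
    rw [Finset.sum_insert hi₀] at hy
    by_cases h0 : y i₀ = 0
    · rw [h0, map_zero, smul_zero, zero_add] at hy
      intro i hi
      rcases Finset.mem_insert.1 hi with rfl | hi
      · exact h0
      · exact ih y hy i hi
    · exfalso
      have h1 : ∀ i ∈ s, ∀ x, y i₀ * x * y i = y i * x * y i₀ := by
        intro i hi x
        have h2 : ∑ i ∈ s, b i • f (y i) = -(b i₀ • f (y i₀)) := eq_neg_of_add_eq_zero_right hy
        have h3 := ih (fun i => y i₀ * x * y i - y i * x * y i₀) (by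
          have h4 : ∑ i ∈ s, b i • f (y i₀ * x * y i - y i * x * y i₀) =
              f (y i₀) * f x * (∑ i ∈ s, b i • f (y i)) -
                (∑ i ∈ s, b i • f (y i)) * f x * f (y i₀) := by
            simp only [Finset.mul_sum, Finset.sum_mul, ← Finset.sum_sub_distrib]
            refine Finset.sum_congr rfl fun i _ => ?_
            simp only [map_sub, map_mul, smul_sub, mul_smul_comm, smul_mul_assoc]
          rw [h4, h2]
          simp only [mul_neg, neg_mul, mul_smul_comm, smul_mul_assoc, sub_self]) i hi
        exact sub_eq_zero.1 h3
      have h2 : ∀ i ∈ s, ∃ q : ℚ, y i = q • y i₀ := fun i hi => by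
        obtain ⟨p, r, hp, hpr⟩ := h.proportional_of_exchange hq h0 (h1 i hi)
        exact ⟨p⁻¹ * r, by rw [mul_smul, ← hpr, inv_smul_smul₀ hp]⟩
      choose! q hq' using h2
      have h3 : (b i₀ + ∑ i ∈ s, (q i : L) * b i) • f (y i₀) = 0 := by
        rw [add_smul, Finset.sum_smul, ← hy]
        congr 1
        refine Finset.sum_congr rfl fun i hi => ?_
        rw [hq' i hi, map_rat_smul_eq (L := L), smul_smul, mul_comm]
      rcases smul_eq_zero.1 h3 with h4 | h4
      · rw [linearIndependent_iff'] at hb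
        have h5 := hb (insert i₀ s) (fun i => if i = i₀ then 1 else q i) (by
          rw [Finset.sum_insert hi₀, if_pos rfl, one_smul, ← h4]
          congr 1
          refine Finset.sum_congr rfl fun i hi => ?_
          have hne : i ≠ i₀ := fun hh => hi₀ (hh ▸ hi)
          rw [if_neg hne, Rat.smul_def]) i₀ (Finset.mem_insert_self _ _)
        simp at h5
      · exact h0 (hf (by rw [h4, map_zero]))

theorem linearIndependent_map (h : IsWittLike ℚ I e)
    (hq : Function.Injective (quant ℚ (gens I e))) {f : A →+* S} (hf : Function.Injective f)
    {κ : Type*} {v : κ → A} (hv : LinearIndependent ℚ v) :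
    LinearIndependent L fun t => f (v t) := by
  classical
  rw [linearIndependent_iff']
  intro s g hg t ht
  let b := Module.Basis.ofVectorSpace ℚ L
  let Y := s.biUnion fun t => (b.repr (g t)).support
  have h1 : ∀ t ∈ s, g t = ∑ i ∈ Y, ((b.repr (g t) i : ℚ) : L) * b i := by
    intro t ht
    conv_lhs => rw [← b.linearCombination_repr (g t), Finsupp.linearCombination_apply,
      Finsupp.sum_of_support_subset (s := Y) _ (Finset.subset_biUnion_of_mem
        (fun t => (b.repr (g t)).support) ht) _ (by simp)]
    exact Finset.sum_congr rfl fun i _ => Rat.smul_def _ _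
  have h2 : ∑ i ∈ Y, b i • f (∑ t ∈ s, b.repr (g t) i • v t) = 0 := by
    rw [← hg]
    simp only [map_sum, map_rat_smul_eq (L := L), Finset.smul_sum]
    rw [Finset.sum_comm]
    refine Finset.sum_congr rfl fun t ht => ?_
    conv_rhs => rw [h1 t ht]
    rw [Finset.sum_smul]
    refine Finset.sum_congr rfl fun i _ => ?_
    rw [smul_smul, mul_comm]
  have h3 := h.eq_zero_of_sum_smul_map hq hf b.linearIndependent Y _ h2
  rw [linearIndependent_iff'] at hv
  rw [h1 t ht]
  refine Finset.sum_eq_zero fun i hi => ?_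
  rw [hv s _ (h3 i hi) t ht]
  simp

/-- There is no injective ring homomorphism to an algebra of polynomial growth. -/
theorem not_injective_of_hasPolynomialGrowth (h : IsWittLike ℚ I e)
    (hq : Function.Injective (quant ℚ (gens I e))) (hS : HasPolynomialGrowth L S) (f : A →+* S) :
    ¬ Function.Injective f := by
  classical
  intro hf
  obtain ⟨p, F, hmono, hmul, hone, hex, hdim⟩ := hS
  choose σ hσ using hex
  set r := 2 * p + 1 with hr
  have hI : ∀ i : Fin r, ((i : ℕ) : ℤ) + 1 ∈ I := fun i =>
    h.upper (show (1 : ℤ) ≤ (i : ℕ) + 1 by omega) h.one_mem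
  let E : Fin r → I := fun i => ⟨_, hI i⟩
  have hE : Function.Injective E := fun i j hij => by
    have := congrArg Subtype.val hij
    simp only [E] at this
    ext; omega
  set s := ∑ i, σ (f (gens I e (E i))) with hs
  have hEs : ∀ i, f (gens I e (E i)) ∈ F s := fun i =>
    hmono (Finset.single_le_sum (f := fun i => σ (f (gens I e (E i)))) (fun _ _ => Nat.zero_le _)
      (Finset.mem_univ i)) (hσ _)
  set c := 2 * (r * s) + 3 with hc
  set n := c ^ (2 * p) + 1 with hn
  let m : (Fin r → Fin n) → I →₀ ℕ := fun t =>
    Finsupp.mapDomain E (Finsupp.equivFunOnFinite.symm fun i => (t i : ℕ))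
  have hm : Function.Injective m := fun t t' htt' => by
    have h1 := Finsupp.mapDomain_injective hE htt'
    have h2 := Finsupp.equivFunOnFinite.symm.injective h1
    funext i
    exact Fin.ext (congrFun h2 i)
  have hdeg : ∀ t, (m t).degree ≤ r * n := fun t => by
    simp only [m]
    rw [Finsupp.degree_mapDomain, Finsupp.degree_eq_sum]
    refine (Finset.sum_le_card_nsmul _ _ n fun i _ => ?_).trans (by simp)
    exact (t i).2.le
  have hmem : ∀ t, f (mon (gens I e) (m t)) ∈ F (r * n * s) := fun t => by
    refine hmono (Nat.mul_le_mul_right s (hdeg t)) ?_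
    have h1 := word_map_mem f (e := gens I e) hmul hone (s := s) (Finsupp.toMultiset (m t)).toList
      fun i hi => by
        rw [Multiset.mem_toList, Finsupp.mem_toMultiset] at hi
        have h2 := Finsupp.mapDomain_support hi
        obtain ⟨j, -, rfl⟩ := Finset.mem_image.1 h2
        exact hEs j
    rw [← wt_one, wt_toList, mwt_one] at h1
    exact h1
  have hind : LinearIndependent ℚ fun t => mon (gens I e) (m t) := by
    have h1 := ((basisMonomials I ℚ).linearIndependent.comp m hm).map' (quant ℚ (gens I e))
      (LinearMap.ker_eq_bot.2 hq)
    have h2 : (fun t => mon (gens I e) (m t)) =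
        quant ℚ (gens I e) ∘ basisMonomials I ℚ ∘ m := by
      funext t
      simp
    rw [h2]
    exact h1
  have hind' := h.linearIndependent_map (L := L) hq hf hind
  obtain ⟨hfin, hrank⟩ := hdim (r * n * s)
  have hind'' : LinearIndependent L fun t => (⟨_, hmem t⟩ : F (r * n * s)) :=
    LinearIndependent.of_comp (F (r * n * s)).subtype hind'
  have h1 := hind''.fintype_card_le_finrank.trans hrank
  rw [Fintype.card_fun, Fintype.card_fin, Fintype.card_fin] at h1
  have hn1 : 1 ≤ n := by omega
  have h2 : (2 * (r * n * s) + 3) * (r * n * s + 2) ≤ (c * n) ^ 2 := by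
    rw [sq]
    refine Nat.mul_le_mul ?_ ?_ <;> rw [hc] <;> nlinarith [Nat.zero_le (r * s)]
  have h3 : n ^ r ≤ (c * n) ^ (2 * p) :=
    h1.trans ((Nat.pow_le_pow_left h2 p).trans_eq (by rw [← pow_mul]))
  rw [hr, pow_succ, mul_pow, mul_comm] at h3
  have h4 : 0 < n ^ (2 * p) := Nat.pow_pos hn1
  have := Nat.le_of_mul_le_mul_right h3 h4
  omega

end IsWittLike

/-! ### The representation that gives the derivatives -/

namespace IsWittLike

section Jet

variable (C : Type*) {R : Type*} [CommRing C] [Ring R] [Algebra C R]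

/-- The operator of the generator `e k` on the `1`-jets with coefficients in `R`. -/
def jet (e : ℤ → R) (k : ℤ) : Module.End C (R × (ℤ → R)) where
  toFun x := (e k * x.1, fun m => (if m = k then x.1 else 0) + e k * x.2 m +
    ((m - k : ℤ) : C) • x.2 (m - k))
  map_add' x y := by
    ext m
    · simp [mul_add]
    · by_cases h : m = k
      · simp [h, mul_add]; abel
      · simp only [Prod.fst_add, Prod.snd_add, Pi.add_apply, if_neg h, mul_add, smul_add]; abel
  map_smul' c x := by
    ext m
    · simp
    · by_cases h : m = k
      · simp [h, smul_add]
      · simp only [Prod.smul_fst, Prod.smul_snd, Pi.smul_apply, if_neg h, mul_smul_comm, zero_add,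
          smul_add, RingHom.id_apply, smul_comm c]

theorem jet_apply (e : ℤ → R) (k : ℤ) (x : R × (ℤ → R)) : jet C e k x =
    (e k * x.1, fun m => (if m = k then x.1 else 0) + e k * x.2 m +
      ((m - k : ℤ) : C) • x.2 (m - k)) := rfl

theorem jet_commutator {e : ℤ → R} {i j : ℤ} {z : C}
    (h : e i * e j - e j * e i = ((j - i : ℤ) : C) • e (i + j) + algebraMap C R z) :
    jet C e i * jet C e j - jet C e j * jet C e i =
      ((j - i : ℤ) : C) • jet C e (i + j) + algebraMap C _ z := by
  have h' : ∀ x : R, e i * (e j * x) - e j * (e i * x) =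
      ((j - i : ℤ) : C) • (e (i + j) * x) + z • x := fun x => by
    rw [← mul_assoc, ← mul_assoc, ← sub_mul, h, add_mul, smul_mul_assoc, Algebra.smul_def z]
  refine LinearMap.ext fun x => Prod.ext ?_ (funext fun m => ?_)
  · simpa [jet_apply] using h' x.1
  · have h1 := h' (x.2 m)
    have e1 : m - i - j = m - (i + j) := by ring
    have e2 : m - j - i = m - (i + j) := by ring
    have e3 : (m - i = j) ↔ m = i + j := by omega
    have e4 : (m - j = i) ↔ m = i + j := by omega
    have h2 : ∀ y : R, (((m - i : ℤ) : C) * ((m - i - j : ℤ) : C)) • y -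
        (((m - j : ℤ) : C) * ((m - j - i : ℤ) : C)) • y =
        (((j - i : ℤ) : C) * ((m - (i + j) : ℤ) : C)) • y := fun y => by
      rw [← sub_smul]; congr 1; push_cast; ring
    have h3 : ∀ y : R, ((m - i : ℤ) : C) • y - ((m - j : ℤ) : C) • y = ((j - i : ℤ) : C) • y :=
      fun y => by rw [← sub_smul]; congr 1; push_cast; ring
    have h2' := h2 (x.2 (m - (i + j)))
    have h3' := h3 (if m = i + j then x.1 else 0)
    simp only [LinearMap.sub_apply, Module.End.mul_apply, jet_apply, LinearMap.add_apply,
      LinearMap.smul_apply, Module.algebraMap_end_apply, Prod.snd_sub, Prod.snd_add, Prod.smul_snd,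
      Pi.sub_apply, Pi.add_apply, Pi.smul_apply, mul_add, smul_add, mul_smul_comm, smul_smul,
      e1, e2, e3, e4] at h1 h2' h3' ⊢
    have e5 : e i * (if m = j then x.1 else 0) = if m = j then e i * x.1 else 0 := by
      split_ifs <;> simp
    have e6 : e j * (if m = i then x.1 else 0) = if m = i then e j * x.1 else 0 := by
      split_ifs <;> simp
    rw [e5, e6]
    rw [← sub_eq_zero] at h1 h2' h3' ⊢
    have key := congrArg₂ (· + ·) (congrArg₂ (· + ·) h1 h2') h3'
    simp only [add_zero] at key
    refine Eq.trans ?_ key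
    abel

theorem exists_hasDerivatives {I : Set ℤ} {e : ℤ → R} (hgen : Algebra.adjoin C (e '' I) = ⊤)
    (ρ : R →ₐ[C] Module.End C (R × (ℤ → R))) (hρ : ∀ k ∈ I, ρ (e k) = jet C e k) :
    ∃ θ, HasDerivatives C I e θ := by
  have h1 : ∀ u x, (ρ u x).1 = u * x.1 := by
    intro u
    have hu : u ∈ Algebra.adjoin C (e '' I) := hgen ▸ trivial
    induction hu using Algebra.adjoin_induction with
    | mem u hu =>
      obtain ⟨k, hk, rfl⟩ := hu
      intro x; rw [hρ k hk, jet_apply]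
    | algebraMap r => intro x; simp [Algebra.smul_def]
    | add u v _ _ hu hv => intro x; simp [hu, hv, add_mul]
    | mul u v _ _ hu hv => intro x; simp [hu, hv, mul_assoc]
  refine ⟨fun n => LinearMap.proj n ∘ₗ LinearMap.snd C R (ℤ → R) ∘ₗ
    LinearMap.applyₗ ((1, 0) : R × (ℤ → R)) ∘ₗ ρ.toLinearMap, fun n => ?_, fun n k hk u => ?_⟩
  · simp
  · simp [hρ k hk, jet_apply, h1]

end Jet

end IsWittLike

/-! ### Enveloping algebras of central extensions of the Witt algebra and its subalgebras -/

attribute [local instance 100] LieRing.ofAssociativeRing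

namespace UniversalEnvelopingAlgebra

variable {K L : Type*} [Field K] [LieRing L] [LieAlgebra K L]

theorem adjoin_range_ι :
    Algebra.adjoin K (Set.range (ι K : L → UniversalEnvelopingAlgebra K L)) = ⊤ := by
  rw [eq_top_iff]
  rintro x -
  let B := Algebra.adjoin K (Set.range (ι K : L → UniversalEnvelopingAlgebra K L))
  let f : L →ₗ⁅K⁆ B :=
    { toFun := fun x => ⟨ι K x, Algebra.subset_adjoin ⟨x, rfl⟩⟩
      map_add' := fun x y => Subtype.ext (map_add _ x y)
      map_smul' := fun a x => Subtype.ext (map_smul _ a x)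
      map_lie' := fun {x y} => Subtype.ext (LieHom.map_lie (ι K) x y) }
  have h : B.val.comp (lift K f) = AlgHom.id K _ := by
    ext x
    change (lift K f (ι K x) : UniversalEnvelopingAlgebra K L) = ι K x
    rw [lift_ι_apply]
    rfl
  have := DFunLike.congr_fun h x
  rw [← AlgHom.id_apply (R := K) x, ← this]
  exact (lift K f x).2

theorem ι_mul_sub (x y : L) : ι K x * ι K y - ι K y * ι K x = ι K ⁅x, y⁆ :=
  (LieHom.map_lie (ι K) x y).symm

end UniversalEnvelopingAlgebra

/-- `L` is an extension, with the cocycle `ω`, of the span of the `e n`, `n ∈ S`, in the Witt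
algebra by the span of `c`; the maps `j` and `τ` give the components of the elements of `L`. -/
structure IsWittExtension {K L : Type*} [Field K] [LieRing L] [LieAlgebra K L] (S : Set ℤ)
    (j : L →ₗ[K] Witt K) (τ : L →ₗ[K] K) (ω : Witt K →ₗ[K] Witt K →ₗ[K] K) (v : ℤ → L) (c : L) :
    Prop where
  one_mem : 1 ∈ S
  upper : IsUpperSet S
  add_mem : ∀ i ∈ S, ∀ k ∈ S, i ≠ k → i + k ∈ S
  map_lie : ∀ x y, j ⁅x, y⁆ = ⁅j x, j y⁆
  map_lie' : ∀ x y, τ ⁅x, y⁆ = ω (j x) (j y)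
  cocycle : ∀ i k, i + k ≠ 0 → ω (Witt.e K i) (Witt.e K k) = 0
  map_v : ∀ n ∈ S, j (v n) = Witt.e K n
  map_v' : ∀ n ∈ S, τ (v n) = 0
  map_c : j c = 0
  lie_v : ∀ i ∈ S, ∀ k ∈ S,
    ⁅v i, v k⁆ = ((k - i : ℤ) : K) • v (i + k) + ω (Witt.e K i) (Witt.e K k) • c
  span : Submodule.span K (insert c (v '' S)) = ⊤

namespace IsWittExtension

open UniversalEnvelopingAlgebra

variable {K L : Type*} [Field K] [LieRing L] [LieAlgebra K L] {S : Set ℤ}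
    {j : L →ₗ[K] Witt K} {τ : L →ₗ[K] K} {ω : Witt K →ₗ[K] Witt K →ₗ[K] K} {v : ℤ → L} {c : L}

theorem map_mem (h : IsWittExtension S j τ ω v c) (x : L) :
    j x ∈ Submodule.span K (Witt.e K '' S) := by
  have hx : x ∈ Submodule.span K (insert c (v '' S)) := h.span ▸ trivial
  induction hx using Submodule.span_induction with
  | mem x hx =>
    rcases hx with rfl | ⟨n, hn, rfl⟩
    · rw [h.map_c]; exact zero_mem _
    · rw [h.map_v n hn]; exact Submodule.subset_span ⟨n, hn, rfl⟩
  | zero => rw [map_zero]; exact zero_mem _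
  | add x y _ _ hx hy => rw [map_add]; exact AddMemClass.add_mem hx hy
  | smul a x _ hx => rw [map_smul]; exact Submodule.smul_mem _ a hx

/-- The universal property. -/
theorem exists_lift (h : IsWittExtension S j τ ω v c) {B : Type*} [Ring B] [Algebra K B]
    (T : ℤ → B) (z : B) (hz : ∀ n ∈ S, Commute (T n) z)
    (hT : ∀ i ∈ S, ∀ k ∈ S, T i * T k - T k * T i =
      ((k - i : ℤ) : K) • T (i + k) + ω (Witt.e K i) (Witt.e K k) • z) :
    ∃ ρ : UniversalEnvelopingAlgebra K L →ₐ[K] B,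
      (∀ n ∈ S, ρ (ι K (v n)) = T n) ∧ ρ (ι K c) = τ c • z := by
  let f : Witt K →ₗ[K] B := (Witt.basis K).constr K T
  have hf : ∀ n, f (Witt.e K n) = T n := fun n => (Witt.basis K).constr_basis K T n
  have hzf : ∀ x ∈ Submodule.span K (Witt.e K '' S), Commute (f x) z := fun x hx => by
    induction hx using Submodule.span_induction with
    | mem x hx => obtain ⟨n, hn, rfl⟩ := hx; rw [hf]; exact hz n hn
    | zero => rw [map_zero]; exact Commute.zero_left z
    | add x y _ _ hx hy => rw [map_add]; exact hx.add_left hy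
    | smul a x _ hx => rw [map_smul]; exact hx.smul_left a
  have key : ∀ x ∈ Submodule.span K (Witt.e K '' S), ∀ y ∈ Submodule.span K (Witt.e K '' S),
      f x * f y - f y * f x = f ⁅x, y⁆ + ω x y • z := fun x hx y hy => by
    induction hx using Submodule.span_induction with
    | mem x hx =>
      obtain ⟨i, hi, rfl⟩ := hx
      induction hy using Submodule.span_induction with
      | mem y hy =>
        obtain ⟨k, hk, rfl⟩ := hy
        rw [Witt.lie_e_e, map_smul, hf, hf, hf, hT i hi k hk]
      | zero => simp
      | add x y _ _ hx hy =>
        rw [lie_add, map_add, map_add, map_add, mul_add, add_mul, add_smul, add_sub_add_comm, hx,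
          hy]
        abel
      | smul a x _ hx =>
        rw [lie_smul, map_smul, map_smul, map_smul, mul_smul_comm, smul_mul_assoc, ← smul_sub, hx,
          smul_add, smul_assoc]
    | zero => simp
    | add x y _ _ hx hy =>
      rw [add_lie, map_add, map_add, map_add, LinearMap.add_apply, mul_add, add_mul, add_smul,
        add_sub_add_comm, hx, hy]
      abel
    | smul a x _ hx =>
      rw [smul_lie, map_smul, map_smul, map_smul, LinearMap.smul_apply, mul_smul_comm,
        smul_mul_assoc, ← smul_sub, hx, smul_add, smul_assoc]
  let F : L →ₗ⁅K⁆ B :=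
    { f ∘ₗ j + τ.smulRight z with
      map_lie' := fun {x y} => by
        have h1 := key _ (h.map_mem x) _ (h.map_mem y)
        have h2 := (hzf _ (h.map_mem x)).eq
        have h3 := (hzf _ (h.map_mem y)).eq
        change f (j ⁅x, y⁆) + τ ⁅x, y⁆ • z =
          (f (j x) + τ x • z) * (f (j y) + τ y • z) - (f (j y) + τ y • z) * (f (j x) + τ x • z)
        rw [h.map_lie, h.map_lie', ← h1]
        simp only [mul_add, add_mul, mul_smul_comm, smul_mul_assoc, smul_add, h2, h3,
          smul_comm (τ x) (τ y)]
        abel }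
  have hF : ∀ x, F x = f (j x) + τ x • z := fun x => rfl
  refine ⟨lift K F, fun n hn => ?_, ?_⟩
  · rw [lift_ι_apply, hF, h.map_v n hn, h.map_v' n hn, hf, zero_smul, add_zero]
  · rw [lift_ι_apply, hF, h.map_c, map_zero, zero_add]

variable {C R : Type*} [CommRing C] [Algebra K C] [Ring R] [Algebra K R] [Algebra C R]
  [IsScalarTower K C R]

theorem commutator (h : IsWittExtension S j τ ω v c) {π : UniversalEnvelopingAlgebra K L →ₐ[K] R}
    {γ : C} (hγ : π (ι K c) = algebraMap C R γ) {i k : ℤ} (hi : i ∈ S) (hk : k ∈ S) :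
    π (ι K (v i)) * π (ι K (v k)) - π (ι K (v k)) * π (ι K (v i)) =
      ((k - i : ℤ) : C) • π (ι K (v (i + k))) +
        algebraMap C R (ω (Witt.e K i) (Witt.e K k) • γ) := by
  have h1 : π (ι K (v i)) * π (ι K (v k)) - π (ι K (v k)) * π (ι K (v i)) =
      π (ι K ⁅v i, v k⁆) := by
    rw [← ι_mul_sub, map_sub, map_mul π, map_mul π]
  rw [h1, h.lie_v i hi k hk, map_add, map_add, map_smul, map_smul, map_smul, map_smul, hγ,
    Algebra.algebraMap_eq_smul_one, Algebra.algebraMap_eq_smul_one, smul_assoc,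
    ← map_intCast (algebraMap K C), algebraMap_smul]

theorem isWittLike (h : IsWittExtension S j τ ω v c) {π : UniversalEnvelopingAlgebra K L →ₐ[K] R}
    (hπ : Function.Surjective π) {γ : C} (hγ : π (ι K c) = algebraMap C R γ) :
    IsWittLike C S fun n => π (ι K (v n)) where
  one_mem := h.one_mem
  upper := h.upper
  add_mem := h.add_mem
  comm i hi k hk := by
    refine ⟨ω (Witt.e K i) (Witt.e K k) • γ, fun hik => by rw [h.cocycle i k hik, zero_smul], ?_⟩
    exact h.commutator hγ hi hk
  gen := by
    rw [eq_top_iff]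
    rintro y -
    obtain ⟨x, rfl⟩ := hπ y
    have hs : ∀ (a : K) (y : R), a • y = algebraMap K C a • y := fun a y =>
      (algebraMap_smul C a y).symm
    set N := Algebra.adjoin C ((fun n => π (ι K (v n))) '' S) with hN
    have h0 : ∀ x : L, x ∈ Submodule.span K (insert c (v '' S)) := fun x => by
      rw [h.span]; trivial
    have h1 : ∀ x, π (ι K x) ∈ N := fun x => by
      have hx : x ∈ Submodule.span K (insert c (v '' S)) := h0 x
      induction hx using Submodule.span_induction with
      | mem x hx =>
        rcases hx with rfl | ⟨n, hn, rfl⟩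
        · rw [hγ]; exact N.algebraMap_mem γ
        · exact hN ▸ Algebra.subset_adjoin ⟨n, hn, rfl⟩
      | zero => rw [map_zero, map_zero]; exact zero_mem _
      | add x y _ _ hx hy => rw [map_add, map_add]; exact AddMemClass.add_mem hx hy
      | smul a x _ hx => rw [map_smul, map_smul, hs]; exact N.smul_mem hx _
    have hx : x ∈ Algebra.adjoin K (Set.range (ι K : L → UniversalEnvelopingAlgebra K L)) := by
      rw [adjoin_range_ι]; trivial
    induction hx using Algebra.adjoin_induction with
    | mem x hx => obtain ⟨x, rfl⟩ := hx; exact h1 x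
    | algebraMap a =>
      rw [AlgHom.commutes, IsScalarTower.algebraMap_apply K C R]
      exact N.algebraMap_mem _
    | add x y _ _ hx hy => rw [map_add]; exact N.add_mem hx hy
    | mul x y _ _ hx hy => rw [map_mul]; exact N.mul_mem hx hy

theorem exists_hasDerivatives (h : IsWittExtension S j τ ω v c)
    {π : UniversalEnvelopingAlgebra K L →ₐ[K] R}
    (hπ : Function.Surjective π) {γ : C} (hγ : π (ι K c) = algebraMap C R γ)
    (hker : ∀ J : TwoSidedIdeal (UniversalEnvelopingAlgebra K L),
      (∀ κ, algebraMap K C κ = γ → ι K c - algebraMap K _ κ ∈ J) → ∀ x, π x = 0 → x ∈ J)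
    (hτ : τ c • γ = γ) (hC : Algebra.adjoin K {γ} = ⊤) :
    ∃ θ, IsWittLike.HasDerivatives C S (fun n => π (ι K (v n))) θ := by
  have hW := h.isWittLike hπ hγ
  set e : ℤ → R := fun n => π (ι K (v n)) with he
  obtain ⟨ρ, hρ, hρc⟩ := h.exists_lift (B := Module.End C (R × (ℤ → R))) (IsWittLike.jet C e)
    (algebraMap C _ γ) (fun n _ => Algebra.commute_algebraMap_right _ _) (fun i hi k hk => by
      have h1 : e i * e k - e k * e i = ((k - i : ℤ) : C) • e (i + k) +
          algebraMap C R (ω (Witt.e K i) (Witt.e K k) • γ) :=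
        h.commutator hγ hi hk
      rw [IsWittLike.jet_commutator C h1]
      congr 1
      · rw [← map_intCast (algebraMap K C), algebraMap_smul]
      · rw [Algebra.algebraMap_eq_smul_one, Algebra.algebraMap_eq_smul_one, smul_assoc])
  replace hρc : ρ (ι K c) = algebraMap C _ γ := by
    rw [hρc, Algebra.algebraMap_eq_smul_one, ← smul_assoc, hτ]
  have hkerρ : ∀ x, π x = 0 → ρ x = 0 := fun x hx => by
    have := hker (TwoSidedIdeal.ker ρ) (fun κ hκ => by
      rw [TwoSidedIdeal.mem_ker, map_sub, hρc, AlgHom.commutes, ← hκ,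
        IsScalarTower.algebraMap_apply K C (Module.End C _), sub_self]) x hx
    exact (TwoSidedIdeal.mem_ker _).1 this
  let σ : R →+* Module.End C (R × (ℤ → R)) :=
    RingHom.liftOfSurjective π.toRingHom hπ ⟨ρ.toRingHom, fun x hx => hkerρ x hx⟩
  have hσ : ∀ x, σ (π x) = ρ x := fun x => RingHom.liftOfRightInverse_comp_apply
    π.toRingHom _ (Function.rightInverse_surjInv hπ) ⟨ρ.toRingHom, fun x hx => hkerρ x hx⟩ x
  have hσC : ∀ a : C, σ (algebraMap C R a) = algebraMap C _ a := fun a => by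
    have ha : a ∈ Algebra.adjoin K {γ} := hC ▸ trivial
    induction ha using Algebra.adjoin_induction with
    | mem x hx => rw [Set.mem_singleton_iff.1 hx, ← hγ, hσ, hρc]
    | algebraMap a =>
      rw [← IsScalarTower.algebraMap_apply K C R, ← π.commutes, hσ, ρ.commutes,
        ← IsScalarTower.algebraMap_apply K C (Module.End C _)]
    | add x y _ _ hx hy => simp only [map_add, hx, hy]
    | mul x y _ _ hx hy => simp only [map_mul, hx, hy]
  exact IsWittLike.exists_hasDerivatives C hW.gen { σ with commutes' := hσC }
    fun k hk => (hσ _).trans (hρ k hk)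

end IsWittExtension

/-! ### Change of the algebra and of the scalars -/

theorem WeightedWords.map_word {R S F ι : Type*} [Ring R] [Ring S] [FunLike F R S]
    [RingHomClass F R S] (f : F) (e : ι → R) (l : List ι) :
    f (word e l) = word (fun i => f (e i)) l := by
  induction l with
  | nil => simp
  | cons i l ih => rw [word_cons, map_mul, ih, word_cons]

namespace IsWittLike

section BaseChange

variable {C D R S : Type*} [CommRing C] [CommRing D] [Algebra C D] [Ring R] [Algebra C R] [Ring S]
  [Algebra C S] [Algebra D S] [IsScalarTower C D S] {I : Set ℤ} {e : ℤ → R}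

theorem baseChange (h : IsWittLike C I e) (f : R →ₐ[C] S)
    (hf : Algebra.adjoin D (Set.range f) = ⊤) : IsWittLike D I fun n => f (e n) where
  one_mem := h.one_mem
  upper := h.upper
  add_mem := h.add_mem
  comm i hi j hj := by
    obtain ⟨z, hz, hij⟩ := h.comm i hi j hj
    refine ⟨algebraMap C D z, fun hne => by rw [hz hne, map_zero], ?_⟩
    rw [← map_mul, ← map_mul, ← map_sub, hij, map_add, map_smul, AlgHom.commutes,
      ← IsScalarTower.algebraMap_apply C D S, ← map_intCast (algebraMap C D), algebraMap_smul]
  gen := by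
    rw [eq_top_iff, ← hf]
    refine Algebra.adjoin_le ?_
    rintro _ ⟨x, rfl⟩
    have hx : x ∈ Algebra.adjoin C (e '' I) := h.gen ▸ trivial
    set N := Algebra.adjoin D ((fun n => f (e n)) '' I) with hN
    change f x ∈ N
    induction hx using Algebra.adjoin_induction with
    | mem x hx => obtain ⟨n, hn, rfl⟩ := hx; exact Algebra.subset_adjoin ⟨n, hn, rfl⟩
    | algebraMap a =>
      rw [AlgHom.commutes, IsScalarTower.algebraMap_apply C D S]
      exact N.algebraMap_mem _
    | add x y _ _ hx hy => rw [map_add]; exact N.add_mem hx hy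
    | mul x y _ _ hx hy => rw [map_mul]; exact N.mul_mem hx hy

theorem quant_baseChange (f : R →ₐ[C] S) (P : MvPolynomial I C) :
    quant D (gens I fun n => f (e n)) (MvPolynomial.map (algebraMap C D) P) =
      f (quant C (gens I e) P) := by
  induction P using MvPolynomial.induction_on' with
  | add p q hp hq => simp only [map_add, hp, hq]
  | monomial m a =>
    rw [map_monomial, quant_monomial, quant_monomial, map_smul, algebraMap_smul, mon, mon, map_word]
    rfl

theorem quant_not_injective (h : IsWittLike C I e) {f : R →ₐ[C] S}
    (hD : Function.Injective (algebraMap C D)) {x : R} (hx : x ≠ 0) (hfx : f x = 0) :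
    ¬ Function.Injective (quant D (gens I fun n => f (e n))) := fun hinj => by
  obtain ⟨P, rfl⟩ := h.quant_surjective x
  rw [← quant_baseChange (D := D), ← map_zero (quant D (gens I fun n => f (e n)))] at hfx
  have h1 := hinj hfx
  rw [← map_zero (MvPolynomial.map (algebraMap C D))] at h1
  rw [MvPolynomial.map_injective _ hD h1, map_zero] at hx
  exact hx rfl

end BaseChange

end IsWittLike

/-! ### The positive Witt algebra over the rational numbers -/

theorem IsWittExtension.of_injective {K L : Type*} [Field K] [LieRing L] [LieAlgebra K L]
    {S : Set ℤ} (h1 : 1 ∈ S) (hS : IsUpperSet S) (hadd : ∀ i ∈ S, ∀ k ∈ S, i ≠ k → i + k ∈ S)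
    (j : L →ₗ⁅K⁆ Witt K) (hj : Function.Injective j) (v : ℤ → L)
    (hv : ∀ n ∈ S, j (v n) = Witt.e K n) (hr : ∀ x, j x ∈ Submodule.span K (Witt.e K '' S)) :
    IsWittExtension S (j : L →ₗ[K] Witt K) (0 : L →ₗ[K] K) 0 v 0 where
  one_mem := h1
  upper := hS
  add_mem := hadd
  map_lie x y := LieHom.map_lie j x y
  map_lie' x y := by simp
  cocycle i k _ := by simp
  map_v n hn := hv n hn
  map_v' n _ := by simp
  map_c := by simp
  lie_v i hi k hk := by
    rcases eq_or_ne i k with rfl | hik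
    · simp
    · apply hj
      rw [LieHom.map_lie, hv i hi, hv k hk, Witt.lie_e_e, smul_zero, add_zero, map_smul,
        hv _ (hadd i hi k hk hik)]
  span := by
    rw [eq_top_iff]
    rintro x -
    refine Submodule.span_mono (Set.subset_insert _ _) ?_
    have h2 : j x ∈ (Submodule.span K (v '' S)).map (j : L →ₗ[K] Witt K) := by
      rw [Submodule.map_span]
      have h3 : (fun x => (j : L →ₗ[K] Witt K) x) '' (v '' S) = Witt.e K '' S := by
        rw [Set.image_image]; exact Set.image_congr hv
      rw [h3]
      exact hr x
    obtain ⟨y, hy, hyx⟩ := h2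
    exact hj hyx ▸ hy

section Inclusion

variable (K : Type*) [Field K]

open Classical in
/-- The elements `e n` of a Lie subalgebra of the Witt algebra. -/
def Witt.subE (H : LieSubalgebra K (Witt K)) (n : ℤ) : H :=
  if h : Witt.e K n ∈ H then ⟨Witt.e K n, h⟩ else 0

theorem Witt.isWittExtension (H : LieSubalgebra K (Witt K)) {S : Set ℤ} (h1 : 1 ∈ S)
    (hS : IsUpperSet S) (hadd : ∀ i ∈ S, ∀ k ∈ S, i ≠ k → i + k ∈ S)
    (hH : H.toSubmodule = Submodule.span K (Witt.e K '' S)) :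
    IsWittExtension S (H.incl : H →ₗ[K] Witt K) (0 : H →ₗ[K] K) 0 (Witt.subE K H) 0 :=
  IsWittExtension.of_injective h1 hS hadd H.incl Subtype.val_injective _ (fun n hn => by
    have : Witt.e K n ∈ H := by
      rw [← LieSubalgebra.mem_toSubmodule, hH]; exact Submodule.subset_span ⟨n, hn, rfl⟩
    rw [subE, dif_pos this]; rfl) fun x => by
      rw [← hH]; exact x.2

theorem isWittExtension_wittPos : IsWittExtension {n : ℤ | 1 ≤ n}
    ((wittPos K).incl : wittPos K →ₗ[K] Witt K) (0 : wittPos K →ₗ[K] K) 0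
    (Witt.subE K (wittPos K)) 0 :=
  Witt.isWittExtension K (wittPos K) (show (1 : ℤ) ≤ 1 from le_rfl)
    (fun i j hij (hi : 1 ≤ i) => hi.trans hij)
    (fun i (hi : 1 ≤ i) j (hj : 1 ≤ j) _ => show 1 ≤ i + j by omega) rfl

theorem isWittExtension_cartanW1 : IsWittExtension {n : ℤ | -1 ≤ n}
    ((cartanW1 K).incl : cartanW1 K →ₗ[K] Witt K) (0 : cartanW1 K →ₗ[K] K) 0
    (Witt.subE K (cartanW1 K)) 0 :=
  Witt.isWittExtension K (cartanW1 K) (show (-1 : ℤ) ≤ 1 by norm_num)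
    (fun i j hij (hi : -1 ≤ i) => hi.trans hij)
    (fun i (hi : -1 ≤ i) j (hj : -1 ≤ j) _ => show -1 ≤ i + j by omega) rfl

theorem isWittExtension_witt : IsWittExtension Set.univ
    ((LieHom.id : Witt K →ₗ⁅K⁆ Witt K) : Witt K →ₗ[K] Witt K) (0 : Witt K →ₗ[K] K) 0
    (Witt.e K) 0 :=
  IsWittExtension.of_injective (Set.mem_univ 1) isUpperSet_univ (fun _ _ _ _ _ => trivial) LieHom.id
    Function.injective_id _ (fun _ _ => rfl) fun x => by
      rw [Set.image_univ]
      exact (Witt.basis K).span_eq.ge trivial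

theorem isWittExtension_virasoro : IsWittExtension Set.univ
    ({ toFun := Virasoro.witt, map_add' := Virasoro.witt_add, map_smul' := Virasoro.witt_smul } :
      Virasoro K →ₗ[K] Witt K)
    ({ toFun := Virasoro.central, map_add' := Virasoro.central_add,
       map_smul' := Virasoro.central_smul } : Virasoro K →ₗ[K] K)
    (Virasoro.cocycle K) (Virasoro.e K) (Virasoro.c K) where
  one_mem := trivial
  upper := isUpperSet_univ
  add_mem _ _ _ _ _ := trivial
  map_lie x y := rfl
  map_lie' x y := rfl
  cocycle i k hik := by rw [Virasoro.cocycle_e_e, if_neg hik]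
  map_v _ _ := rfl
  map_v' _ _ := rfl
  map_c := rfl
  lie_v i _ k _ := by rw [Virasoro.lie_e_e, Virasoro.cocycle_e_e]
  span := by
    rw [eq_top_iff]
    rintro x -
    have h1 : ∀ y : Witt K, (⟨y, 0⟩ : Virasoro K) ∈
        Submodule.span K (insert (Virasoro.c K) (Virasoro.e K '' Set.univ)) := fun y => by
      induction y using Witt.induction with
      | add y z hy hz =>
        have : (⟨y + z, 0⟩ : Virasoro K) = ⟨y, 0⟩ + ⟨z, 0⟩ := by ext1 <;> simp
        rw [this]; exact add_mem hy hz
      | smul a y hy =>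
        have : (⟨a • y, 0⟩ : Virasoro K) = a • ⟨y, 0⟩ := by ext1 <;> simp
        rw [this]; exact Submodule.smul_mem _ a hy
      | he n => exact Submodule.subset_span (Or.inr ⟨n, trivial, rfl⟩)
    have h2 : x = ⟨x.witt, 0⟩ + x.central • Virasoro.c K := by
      ext1 <;> simp [Virasoro.c]
    rw [h2]
    exact add_mem (h1 _) (Submodule.smul_mem _ _ (Submodule.subset_span (Set.mem_insert _ _)))

end Inclusion

namespace IsWittExtension

open UniversalEnvelopingAlgebra

variable {K L : Type*} [Field K] [LieRing L] [LieAlgebra K L] {S : Set ℤ}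
    {j : L →ₗ[K] Witt K} {τ : L →ₗ[K] K} {ω : Witt K →ₗ[K] Witt K →ₗ[K] K} {v : ℤ → L}

theorem isWittLike_ι (h : IsWittExtension S j τ ω v 0) :
    IsWittLike K S fun n => ι K (v n) :=
  h.isWittLike (π := AlgHom.id K _) Function.surjective_id (γ := (0 : K)) (by simp)

theorem exists_hasDerivatives_ι (h : IsWittExtension S j τ ω v 0) :
    ∃ θ, IsWittLike.HasDerivatives K S (fun n => ι K (v n)) θ :=
  h.exists_hasDerivatives (π := AlgHom.id K _) Function.surjective_id (γ := (0 : K)) (by simp)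
    (fun J _ x hx => by rw [show x = 0 from hx]; exact zero_mem J) (by simp)
    (Subsingleton.elim _ _)

end IsWittExtension

theorem UniversalEnvelopingAlgebra.nontrivial (K L : Type*) [Field K] [LieRing L]
    [LieAlgebra K L] : Nontrivial (UniversalEnvelopingAlgebra K L) :=
  (lift K (0 : L →ₗ⁅K⁆ K)).toRingHom.domain_nontrivial

namespace IsWittLike

theorem exists_wittPos_embedding_aux : ∃ e : ℤ → UniversalEnvelopingAlgebra ℚ (wittPos ℚ),
    IsWittLike ℚ {n | 1 ≤ n} e ∧ Function.Injective (quant ℚ (gens {n | 1 ≤ n} e)) := by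
  have hL := isWittExtension_wittPos ℚ
  obtain ⟨θ, hθ⟩ := hL.exists_hasDerivatives_ι
  have := UniversalEnvelopingAlgebra.nontrivial ℚ (wittPos ℚ)
  exact ⟨_, hL.isWittLike_ι, hL.isWittLike_ι.quant_injective hθ (algebraMap ℚ _).injective⟩

variable {C R : Type*} [CommRing C] [Nontrivial C] [Algebra ℚ C] [Ring R] [Algebra C R] {I : Set ℤ}
  {e : ℤ → R}

/-- The enveloping algebra of the positive Witt algebra embeds. -/
theorem exists_wittPos_embedding (h : IsWittLike C I e)
    (hq : Function.Injective (quant C (gens I e))) :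
    ∃ g : UniversalEnvelopingAlgebra ℚ (wittPos ℚ) →+* R, Function.Injective g := by
  classical
  let _ : Algebra ℚ R := Algebra.compHom R (algebraMap ℚ C)
  have : IsScalarTower ℚ C R := IsScalarTower.of_algebraMap_eq fun _ => rfl
  have hL := isWittExtension_wittPos ℚ
  set S : Set ℤ := {n | 1 ≤ n} with hS
  have hSI : ∀ n ∈ S, n ∈ I := fun n hn => h.upper (show 1 ≤ n from hn) h.one_mem
  obtain ⟨g, hg, -⟩ := hL.exists_lift (B := R) e 0 (fun n _ => Commute.zero_right _)
    fun i hi k hk => by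
      obtain ⟨z, hz, hik⟩ := h.comm i (hSI i hi) k (hSI k hk)
      have h1 : 1 ≤ i := hi
      have h2 : 1 ≤ k := hk
      rw [hik, hz (by omega), map_zero, smul_zero, ← map_intCast (algebraMap ℚ C), algebraMap_smul]
  have hA := hL.isWittLike_ι
  refine ⟨g, (injective_iff_map_eq_zero _).2 fun x hx => ?_⟩
  obtain ⟨P, rfl⟩ := hA.quant_surjective x
  set E : ℤ → UniversalEnvelopingAlgebra ℚ (wittPos ℚ) :=
    fun n => UniversalEnvelopingAlgebra.ι ℚ (Witt.subE ℚ (wittPos ℚ) n)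
  let r : S → I := fun n => ⟨n, hSI n n.2⟩
  have hr : Function.Injective r := fun a b hab => Subtype.ext (congrArg (fun x : I => (x : ℤ)) hab)
  have hword : ∀ l : List S, g (word (gens S E) l) = word (gens I e) (l.map r) := fun l => by
    rw [WeightedWords.map_word, word, word, List.map_map]
    congr 1
    exact List.map_congr_left fun n _ => hg n n.2
  let Φ : MvPolynomial S ℚ →ₐ[ℚ] MvPolynomial I C :=
    ((rename r : MvPolynomial S C →ₐ[C] MvPolynomial I C).restrictScalars ℚ).comp
      (mapAlgHom (Algebra.ofId ℚ C))
  have hΦ : Function.Injective Φ := (rename_injective r hr).comp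
    (MvPolynomial.map_injective _ (algebraMap ℚ C).injective)
  have hΦX : ∀ l : List S, Φ (l.map X).prod = ((l.map r).map X).prod := fun l => by
    rw [map_list_prod, List.map_map, List.map_map]
    congr 1
    refine List.map_congr_left fun n _ => ?_
    simp [Φ]
  have hfil : ∀ d, ∀ x ∈ DegFil ℚ (gens S E) d, g x ∈ DegFil C (gens I e) d := fun d x hx => by
    refine (Fil_le (N := ((DegFil C (gens I e) d).restrictScalars ℚ).comap g.toLinearMap)
      fun l hl => ?_) hx
    change g _ ∈ DegFil C (gens I e) d
    rw [hword]
    exact word_mem_Fil (by rwa [wt_one, List.length_map, ← wt_one])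
  have hsymb := isSymbol_quant_top (C := ℚ) (e := gens S E) P
  set Q := homogeneousComponent P.totalDegree P with hQ
  have h1 : IsSymbol C (gens I e) P.totalDegree (g (quant ℚ (gens S E) Q)) (Φ Q) := by
    have h2 : Φ Q = ∑ m ∈ Q.support, algebraMap ℚ C (coeff m Q) • Φ (monomial m 1) := by
      conv_lhs => rw [Q.as_sum]
      rw [map_sum]
      refine Finset.sum_congr rfl fun m _ => ?_
      rw [algebraMap_smul, ← map_smul, smul_monomial, smul_eq_mul, mul_one]
    rw [h2, quant_eq_sum, map_sum]
    refine IsSymbol.sum _ fun m hm => ?_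
    rw [map_smul, ← algebraMap_smul C (coeff m Q)]
    refine IsSymbol.smul _ ?_
    have h3 := WeightedWords.isSymbol_word h.commLower_one ((Finsupp.toMultiset m).toList.map r)
    have h4 : ((Finsupp.toMultiset m).toList.map r).length = P.totalDegree := by
      rw [List.length_map, ← wt_one, wt_toList, mwt_one, degree_of_mem_support hsymb.1 hm]
    rwa [← hΦX, ← hword, prod_map_X (m := m) (by simp), h4] at h3
  have h5 := hfil _ _ hsymb.2
  have h6 : IsSymbol C (gens I e) P.totalDegree 0 (Φ Q) := by
    have := (IsSymbol.zero_of_mem h5).add h1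
    rw [← map_add, sub_add_cancel, zero_add] at this
    have hx' : g (quant ℚ (gens S E) P) = 0 := hx
    rwa [hx'] at this
  have h7 : Φ Q = 0 := IsSymbol.unique C h.commLower_one hq h6
    (IsSymbol.zero_of_mem (zero_mem _))
  have h8 : Q = 0 := hΦ (h7.trans (map_zero Φ).symm)
  by_contra h0
  have hP : P ≠ 0 := by rintro rfl; simp at h0
  obtain ⟨m, hm, hm'⟩ := exists_degree_eq_totalDegree hP
  have h9 := mem_support_top.2 ⟨hm, hm'⟩
  rw [← hQ, h8] at h9
  simp at h9

/-- In an algebra that contains the enveloping algebra of the positive Witt algebra the monomials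
are independent. -/
theorem quant_injective_of_embedding {L R : Type*} [Field L] [CharZero L] [Ring R] [Algebra L R]
    {I : Set ℤ} {e : ℤ → R} (h : IsWittLike L I e)
    {g : UniversalEnvelopingAlgebra ℚ (wittPos ℚ) →+* R} (hg : Function.Injective g) :
    Function.Injective (quant L (gens I e)) := by
  obtain ⟨E, hE, hqE⟩ := exists_wittPos_embedding_aux
  by_contra hq
  exact hE.not_injective_of_hasPolynomialGrowth hqE (h.hasPolynomialGrowth hq) g hg

end IsWittLike

/-! ### Bassian and Hopfian rings -/

theorem TwoSidedIdeal.exists_ne_zero {R : Type*} [Ring R] {J : TwoSidedIdeal R} (hJ : J ≠ ⊥) :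
    ∃ x, x ≠ 0 ∧ (J.ringCon.mk' x) = 0 := by
  by_contra! h
  refine hJ (eq_bot_iff.2 fun x hx => ?_)
  rw [TwoSidedIdeal.mem_bot]
  by_contra hx0
  refine h x hx0 ?_
  rw [← map_zero J.ringCon.mk']
  exact (RingCon.eq _).2 ((TwoSidedIdeal.mem_iff J x).1 hx)

theorem IsBassianRing.isHopfianRing {R : Type*} [Ring R] (h : IsBassianRing R) :
    IsHopfianRing R :=
  fun J hJ => ⟨fun f => h J hJ f.toRingHom f.injective⟩

theorem IsWittLike.isBassianRing {K R : Type*} [Field K] [CharZero K] [Ring R] [Algebra K R]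
    {I : Set ℤ} {e : ℤ → R} (h : IsWittLike K I e) {θ : ℤ → R →ₗ[K] R}
    (hθ : HasDerivatives K I e θ) : IsBassianRing R := by
  intro J hJ f hf
  obtain ⟨x, hx, hxJ⟩ := TwoSidedIdeal.exists_ne_zero hJ
  have : Nontrivial R := ⟨x, 0, hx⟩
  obtain ⟨g, hg⟩ := h.exists_wittPos_embedding (h.quant_injective hθ (algebraMap K R).injective)
  have hπ : Function.Surjective (RingCon.mkₐ K J.ringCon) := RingCon.mkₐ_surjective _
  have h1 : IsWittLike K I fun n => RingCon.mkₐ K J.ringCon (e n) :=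
    h.baseChange (D := K) (RingCon.mkₐ K J.ringCon) (by rw [hπ.range_eq, Algebra.adjoin_univ])
  exact h.quant_not_injective (D := K) (f := RingCon.mkₐ K J.ringCon) Function.injective_id hx hxJ
    (h1.quant_injective_of_embedding (g := f.comp g) (hf.comp hg))

open TensorProduct

/-! ### The Hopfian property over a principal ideal domain of central elements -/

namespace IsWittLike

theorem eq_zero_of_smul_eq_zero {C R : Type*} [CommRing C] [IsDomain C] [Ring R] [Algebra C R]
    {I : Set ℤ} {e : ℤ → R} (h : IsWittLike C I e) (hq : Function.Injective (quant C (gens I e)))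
    {c : C} (hc : c ≠ 0) {x : R} (hx : c • x = 0) : x = 0 := by
  obtain ⟨P, rfl⟩ := h.quant_surjective x
  rw [← map_smul] at hx
  have h1 : c • P = 0 := hq (hx.trans (map_zero _).symm)
  rw [(smul_eq_zero.1 h1).resolve_left hc, map_zero]

theorem isHopfianRing {C R : Type*} [CommRing C] [IsDomain C] [IsPrincipalIdealRing C]
    [CharZero C] [Algebra ℚ C] [Ring R] [Algebra C R] {I : Set ℤ} {e : ℤ → R}
    (h : IsWittLike C I e) {θ : ℤ → R →ₗ[C] R} (hθ : HasDerivatives C I e θ)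
    (hinj : Function.Injective (algebraMap C R)) : IsHopfianRing R := by
  refine fun J hJ => ⟨fun φ => ?_⟩
  obtain ⟨x, hx, hxJ⟩ := TwoSidedIdeal.exists_ne_zero hJ
  have : Nontrivial R := ⟨x, 0, hx⟩
  have hq := h.quant_injective hθ hinj
  obtain ⟨g, hg⟩ := h.exists_wittPos_embedding hq
  set S := J.ringCon.Quotient
  have : Nontrivial S := φ.injective.nontrivial
  let π : R →ₐ[C] S := RingCon.mkₐ C J.ringCon
  have hπ : Function.Surjective π := RingCon.mkₐ_surjective _
  -- the elements of `C` act on `S` through the center of `R`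
  have hcen : ∀ c : C, ∃ d : C, φ (algebraMap C R d) = algebraMap C S c := fun c => by
    obtain ⟨d, hd⟩ := h.exists_smul_eq_of_central hq (z := φ.symm (algebraMap C S c)) fun x => by
      apply φ.injective
      rw [map_mul, map_mul, φ.apply_symm_apply, Algebra.commutes]
    exact ⟨d, by rw [hd, φ.apply_symm_apply]⟩
  by_cases hC : Function.Injective (algebraMap C S)
  · let L := FractionRing C
    let S' := TensorProduct C L S
    let ψ : S →ₐ[C] S' := Algebra.TensorProduct.includeRight
    have hψ : ∀ y, ψ y = 0 → ∃ c : C, c ≠ 0 ∧ c • y = 0 := fun y hy => by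
      have hloc : IsLocalizedModule (nonZeroDivisors C) (TensorProduct.mk C L S 1) :=
        (isLocalizedModule_iff_isBaseChange (nonZeroDivisors C) L _).2
          (TensorProduct.isBaseChange C S L)
      obtain ⟨c, hc⟩ := (IsLocalizedModule.eq_zero_iff (nonZeroDivisors C)
        (TensorProduct.mk C L S 1)).1 hy
      exact ⟨c, nonZeroDivisors.ne_zero c.2, hc⟩
    have hadj : Algebra.adjoin L (Set.range (ψ.comp π)) = ⊤ := by
      rw [eq_top_iff]
      rintro y -
      induction y using TensorProduct.induction_on with
      | zero => exact zero_mem _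
      | add y z hy hz => exact AddMemClass.add_mem hy hz
      | tmul l s =>
        obtain ⟨r, rfl⟩ := hπ s
        have h1 : l ⊗ₜ[C] π r = l • (ψ.comp π) r := by
          change _ = l • ((1 : L) ⊗ₜ[C] π r)
          rw [TensorProduct.smul_tmul', smul_eq_mul, mul_one]
        rw [h1]
        exact Subalgebra.smul_mem _ (Algebra.subset_adjoin (Set.mem_range_self r)) l
    have h1 := h.baseChange (D := L) (ψ.comp π) hadj
    have h2 := h1.quant_injective_of_embedding
      (g := (ψ.toRingHom.comp φ.toRingHom).comp g) ?_
    · refine h.quant_not_injective (D := L) (f := ψ.comp π) (IsFractionRing.injective C L) hx ?_ h2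
      exact (congrArg ψ hxJ).trans (map_zero ψ)
    · refine (injective_iff_map_eq_zero _).2 fun a ha => ?_
      obtain ⟨c, hc, hca⟩ := hψ _ ha
      obtain ⟨d, hd⟩ := hcen c
      rw [Algebra.smul_def, ← hd] at hca
      have h3 : d • g a = 0 := by
        rw [Algebra.smul_def]
        apply φ.injective
        rw [map_mul, map_zero]
        exact hca
      have hd0 : d ≠ 0 := by
        rintro rfl
        rw [map_zero, map_zero] at hd
        exact hc (hC (hd.symm.trans (map_zero _).symm))
      exact hg ((h.eq_zero_of_smul_eq_zero hq hd0 h3).trans (map_zero g).symm)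
  · set Q := RingHom.ker (algebraMap C S) with hQ
    have hQ0 : Q ≠ ⊥ := fun h0 => hC ((RingHom.injective_iff_ker_eq_bot _).2 h0)
    have hQ1 : Q ≠ ⊤ := RingHom.ker_ne_top _
    have hprime : Q.IsPrime := ⟨hQ1, fun {a b} hab => by
      obtain ⟨a', ha'⟩ := hcen a
      obtain ⟨b', hb'⟩ := hcen b
      rw [hQ, RingHom.mem_ker, map_mul, ← ha', ← hb', ← map_mul, ← map_mul,
        map_eq_zero_iff φ φ.injective, map_eq_zero_iff _ hinj] at hab
      rcases mul_eq_zero.1 hab with h0 | h0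
      · left; rw [hQ, RingHom.mem_ker, ← ha', h0, map_zero, map_zero]
      · right; rw [hQ, RingHom.mem_ker, ← hb', h0, map_zero, map_zero]⟩
    have hmax : Q.IsMaximal := IsPrime.to_maximal_ideal hQ0
    let _ : Field (C ⧸ Q) := Ideal.Quotient.field Q
    have : CharZero (C ⧸ Q) := algebraRat.charZero _
    let _ : Algebra (C ⧸ Q) S := RingHom.toAlgebra' (Ideal.Quotient.lift Q (algebraMap C S)
      fun a ha => ha) fun d s => by
        obtain ⟨d, rfl⟩ := Ideal.Quotient.mk_surjective d
        exact Algebra.commutes d s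
    have : IsScalarTower C (C ⧸ Q) S := IsScalarTower.of_algebraMap_eq fun _ => rfl
    have h1 : IsWittLike (C ⧸ Q) I fun n => π (e n) :=
      h.baseChange (D := C ⧸ Q) π (by rw [hπ.range_eq, Algebra.adjoin_univ])
    have h2 := h1.quant_injective_of_embedding (g := φ.toRingHom.comp g) (φ.injective.comp hg)
    obtain ⟨a, haQ, ha0⟩ := Submodule.exists_mem_ne_zero_of_ne_bot hQ0
    obtain ⟨d, hd⟩ := h1.exists_smul_eq_of_central h2 (z := φ (algebraMap C R a)) fun y => by
      apply φ.symm.injective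
      rw [map_mul, map_mul, φ.symm_apply_apply, Algebra.commutes]
    have hd0 : d ≠ 0 := by
      rintro rfl
      rw [map_zero, eq_comm, map_eq_zero_iff φ φ.injective, map_eq_zero_iff _ hinj] at hd
      exact ha0 hd
    obtain ⟨b, hb⟩ := Ideal.Quotient.mk_surjective d⁻¹
    obtain ⟨b', hb'⟩ := hcen b
    have h3 : φ (algebraMap C R (a * b')) = φ (algebraMap C R 1) := by
      rw [map_mul, map_mul, ← hd, hb', IsScalarTower.algebraMap_apply C (C ⧸ Q) S,
        Ideal.Quotient.algebraMap_eq, hb, ← map_mul, mul_inv_cancel₀ hd0, map_one, map_one, map_one]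
    have h4 : a * b' = 1 := hinj (φ.injective h3)
    exact hQ1 ((Ideal.eq_top_iff_one Q).2 (h4 ▸ Q.mul_mem_right b' haQ))

end IsWittLike

namespace UniversalEnvelopingAlgebra

variable (K : Type*) {L : Type*} [Field K] [LieRing L] [LieAlgebra K L]

/-- The comultiplication. -/
theorem exists_comul : ∃ Δ : UniversalEnvelopingAlgebra K L →ₐ[K]
      UniversalEnvelopingAlgebra K L ⊗[K] UniversalEnvelopingAlgebra K L,
    ∀ x, Δ (ι K x) = ι K x ⊗ₜ 1 + 1 ⊗ₜ ι K x := by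
  let U := UniversalEnvelopingAlgebra K L
  let F : L →ₗ⁅K⁆ U ⊗[K] U :=
    { (TensorProduct.mk K U U).flip 1 ∘ₗ (ι K : L →ₗ⁅K⁆ U).toLinearMap +
        TensorProduct.mk K U U 1 ∘ₗ (ι K : L →ₗ⁅K⁆ U).toLinearMap with
      map_lie' := fun {x y} => by
        change ι K ⁅x, y⁆ ⊗ₜ[K] (1 : U) + (1 : U) ⊗ₜ[K] ι K ⁅x, y⁆ =
          (ι K x ⊗ₜ[K] (1 : U) + (1 : U) ⊗ₜ[K] ι K x) *
            (ι K y ⊗ₜ[K] (1 : U) + (1 : U) ⊗ₜ[K] ι K y) -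
          (ι K y ⊗ₜ[K] (1 : U) + (1 : U) ⊗ₜ[K] ι K y) *
            (ι K x ⊗ₜ[K] (1 : U) + (1 : U) ⊗ₜ[K] ι K x)
        rw [← ι_mul_sub, TensorProduct.sub_tmul, TensorProduct.tmul_sub]
        simp only [mul_add, add_mul, Algebra.TensorProduct.tmul_mul_tmul, mul_one, one_mul]
        abel }
  exact ⟨lift K F, fun x => lift_ι_apply K F x⟩

theorem transcendental_ι [CharZero K] {x : L} (hx : ι K x ≠ 0) : Transcendental K (ι K x) := by
  intro halg
  obtain ⟨Δ, hΔ⟩ := exists_comul K (L := L)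
  set U := UniversalEnvelopingAlgebra K L
  set y : U := ι K x with hy
  have hint : IsIntegral K y := halg.isIntegral
  have hnt : Nontrivial U := UniversalEnvelopingAlgebra.nontrivial K L
  set q := minpoly K y with hq
  have hq1 : q.Monic := minpoly.monic hint
  set d := q.natDegree with hd
  have hd0 : 0 < d := minpoly.natDegree_pos hint
  have hd1 : d ≠ 1 := fun h1 => by
    obtain ⟨a, ha⟩ := minpoly.natDegree_eq_one_iff.1 h1
    have h2 : lift K (0 : L →ₗ⁅K⁆ K) y = 0 := lift_ι_apply K (0 : L →ₗ⁅K⁆ K) x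
    rw [← ha, AlgHom.commutes] at h2
    rw [show a = 0 from h2, map_zero] at ha
    exact hx ha.symm
  have hlin : LinearIndependent K fun i : Fin d => y ^ (i : ℕ) := linearIndependent_pow y
  obtain ⟨f, hf⟩ := LinearMap.exists_extend ((Module.Basis.span hlin).coord ⟨1, by omega⟩)
  have hfy : ∀ i < d, f (y ^ i) = if i = 1 then 1 else 0 := fun i hi => by
    have h1 := DFunLike.congr_fun hf (Module.Basis.span hlin ⟨i, hi⟩)
    rw [LinearMap.comp_apply, Submodule.subtype_apply, Module.Basis.coord_apply,
      Module.Basis.repr_self, Finsupp.single_apply, Module.Basis.span_apply] at h1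
    simpa [Fin.ext_iff] using h1
  set s := f (y ^ d) with hs
  let Φ : U ⊗[K] U →ₗ[K] U := (TensorProduct.lid K U).toLinearMap ∘ₗ f.rTensor U
  have hΦ : ∀ a b, Φ (a ⊗ₜ b) = f a • b := fun a b => by simp [Φ]
  have hpow : ∀ n ≤ d, Φ (Δ (y ^ n)) = (n : K) • y ^ (n - 1) + if n = d then s • 1 else 0 := by
    intro n hn
    have hcomm : Commute (y ⊗ₜ[K] (1 : U)) ((1 : U) ⊗ₜ[K] y) := by
      simp [Commute, SemiconjBy, Algebra.TensorProduct.tmul_mul_tmul]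
    rw [map_pow, hΔ, hcomm.add_pow, map_sum]
    have h1 : ∀ m ∈ Finset.range (n + 1), Φ ((y ⊗ₜ[K] (1 : U)) ^ m * ((1 : U) ⊗ₜ[K] y) ^ (n - m) *
        (n.choose m : U ⊗[K] U)) = (if m = 1 then (n : K) • y ^ (n - 1) else 0) +
          if m = d then (if n = d then s • 1 else 0) else 0 := fun m hm => by
      have hmn : m ≤ n := Nat.lt_succ_iff.1 (Finset.mem_range.1 hm)
      rw [← nsmul_eq_mul', map_nsmul, Algebra.TensorProduct.tmul_pow,
        Algebra.TensorProduct.tmul_pow, Algebra.TensorProduct.tmul_mul_tmul, one_pow, one_pow,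
        mul_one, one_mul, hΦ]
      rcases (hmn.trans hn).lt_or_eq with hlt | rfl
      · rw [hfy m hlt, if_neg hlt.ne, add_zero]
        split_ifs with h1
        · rw [h1, Nat.choose_one_right, one_smul, Nat.cast_smul_eq_nsmul]
        · simp
      · obtain rfl : n = d := le_antisymm hn hmn
        simp [hd1, hs]
    rw [Finset.sum_congr rfl h1, Finset.sum_add_distrib, Finset.sum_ite_eq', Finset.sum_ite_eq']
    congr 1
    · split_ifs with h2
      · rfl
      · obtain rfl : n = 0 := by rw [Finset.mem_range] at h2; omega
        simp
    · by_cases h2 : n = d <;> simp [h2]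
  have hlead : q.coeff d = 1 := hq1.coeff_natDegree
  have h1 : Polynomial.aeval y (Polynomial.derivative q + Polynomial.C s) = 0 := by
    have h2 : Φ (Δ (Polynomial.aeval y q)) = 0 := by rw [hq, minpoly.aeval, map_zero, map_zero]
    rw [← h2]
    conv_rhs => rw [Polynomial.aeval_eq_sum_range]
    conv_lhs => rw [q.as_sum_range_C_mul_X_pow]
    simp only [map_sum, map_smul, ← hd]
    have h3 : ∑ i ∈ Finset.range (d + 1), q.coeff i • Φ (Δ (y ^ i)) =
        ∑ i ∈ Finset.range (d + 1), q.coeff i • ((i : K) • y ^ (i - 1) +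
          if i = d then s • (1 : U) else 0) := Finset.sum_congr rfl fun i hi => by
      rw [hpow i (Nat.lt_succ_iff.1 (Finset.mem_range.1 hi))]
    rw [h3, map_add, map_sum, Polynomial.aeval_C]
    simp only [smul_add, Finset.sum_add_distrib]
    congr 1
    · refine Finset.sum_congr rfl fun i _ => ?_
      simp [Polynomial.derivative_X_pow, Algebra.smul_def]
    · simp [hlead, Algebra.algebraMap_eq_smul_one]
  have h2 : (Polynomial.derivative q + Polynomial.C s).coeff (d - 1) = d := by
    rw [Polynomial.coeff_add, Polynomial.coeff_derivative, Polynomial.coeff_C_of_ne_zero (by omega),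
      Nat.sub_add_cancel hd0, hlead, Nat.cast_sub hd0]
    simp
  have h3 : Polynomial.derivative q + Polynomial.C s ≠ 0 := fun h0 => by
    rw [h0, Polynomial.coeff_zero, eq_comm, Nat.cast_eq_zero] at h2
    omega
  have h4 := Polynomial.natDegree_le_natDegree (minpoly.degree_le_of_ne_zero K y h3 h1)
  have h5 := Polynomial.natDegree_add_le (Polynomial.derivative q) (Polynomial.C s)
  have h6 := Polynomial.natDegree_derivative_le q
  rw [Polynomial.natDegree_C] at h5
  rw [← hq, ← hd] at h4
  rw [← hd] at h6
  omega

end UniversalEnvelopingAlgebra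

section Main

open UniversalEnvelopingAlgebra

variable (K : Type*) [Field K] [CharZero K]

theorem isBassianRing_wittPos : IsBassianRing (UniversalEnvelopingAlgebra K (wittPos K)) :=
  have h := isWittExtension_wittPos K
  let ⟨_, hθ⟩ := h.exists_hasDerivatives_ι
  h.isWittLike_ι.isBassianRing hθ

theorem isBassianRing_cartanW1 : IsBassianRing (UniversalEnvelopingAlgebra K (cartanW1 K)) :=
  have h := isWittExtension_cartanW1 K
  let ⟨_, hθ⟩ := h.exists_hasDerivatives_ι
  h.isWittLike_ι.isBassianRing hθ

theorem isBassianRing_witt : IsBassianRing (UniversalEnvelopingAlgebra K (Witt K)) :=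
  have h := isWittExtension_witt K
  let ⟨_, hθ⟩ := h.exists_hasDerivatives_ι
  h.isWittLike_ι.isBassianRing hθ

theorem isBassianRing_centralQuotient (κ : K) : IsBassianRing (Virasoro.CentralQuotient K κ) := by
  have h := isWittExtension_virasoro K
  let π := RingCon.mkₐ K (Virasoro.centralIdeal K κ).ringCon
  have hπ : Function.Surjective π := RingCon.mkₐ_surjective _
  have hmem : ∀ x, π x = 0 ↔ x ∈ Virasoro.centralIdeal K κ := fun x => by
    rw [TwoSidedIdeal.mem_iff, ← map_zero π]
    exact RingCon.eq _
  have hγ : π (ι K (Virasoro.c K)) = algebraMap K _ κ := by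
    rw [← sub_eq_zero, ← AlgHom.commutes π, ← map_sub, hmem]
    exact TwoSidedIdeal.subset_span rfl
  obtain ⟨θ, hθ⟩ := h.exists_hasDerivatives hπ hγ (fun J hJ x hx =>
    TwoSidedIdeal.span_le.2 (Set.singleton_subset_iff.2 (hJ κ rfl)) ((hmem x).1 hx))
    (one_smul K κ) (Subsingleton.elim _ _)
  exact (h.isWittLike hπ hγ).isBassianRing hθ

theorem isHopfianRing_virasoro : IsHopfianRing (UniversalEnvelopingAlgebra K (Virasoro K)) := by
  have h := isWittExtension_virasoro K
  have hker : ∀ {C : Type _} [CommRing C] [Algebra K C] (γ : C)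
      (J : TwoSidedIdeal (UniversalEnvelopingAlgebra K (Virasoro K))),
      (∀ κ, algebraMap K C κ = γ → ι K (Virasoro.c K) - algebraMap K _ κ ∈ J) →
      ∀ x, AlgHom.id K (UniversalEnvelopingAlgebra K (Virasoro K)) x = 0 → x ∈ J :=
    fun γ J _ x hx => by rw [show x = 0 from hx]; exact zero_mem J
  by_cases hc : ι K (Virasoro.c K) = 0
  · have hγ : AlgHom.id K _ (ι K (Virasoro.c K)) = algebraMap K _ 0 := by
      rw [map_zero]; exact hc
    obtain ⟨θ, hθ⟩ := h.exists_hasDerivatives Function.surjective_id hγ (hker 0) (smul_zero _)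
      (Subsingleton.elim _ _)
    exact ((h.isWittLike Function.surjective_id hγ).isBassianRing hθ).isHopfianRing
  · have ht := transcendental_ι K hc
    have hcen : ∀ x, Commute (ι K (Virasoro.c K)) x := fun x => by
      have hx : x ∈ Algebra.adjoin K (Set.range (ι K : Virasoro K → _)) := by
        rw [adjoin_range_ι]; trivial
      induction hx using Algebra.adjoin_induction with
      | mem x hx =>
        obtain ⟨x, rfl⟩ := hx
        rw [Commute, SemiconjBy, eq_comm, ← sub_eq_zero, ι_mul_sub, Virasoro.lie_c, map_zero]
      | algebraMap a => exact Algebra.commute_algebraMap_right a _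
      | add x y _ _ hx hy => exact hx.add_right hy
      | mul x y _ _ hx hy => exact hx.mul_right hy
    let _ : Algebra (Polynomial K) (UniversalEnvelopingAlgebra K (Virasoro K)) :=
      RingHom.toAlgebra' (Polynomial.aeval (ι K (Virasoro.c K))).toRingHom fun p x => by
        induction p using Polynomial.induction_on' with
        | add p q hp hq => rw [map_add, add_mul, mul_add, hp, hq]
        | monomial n a =>
          change Polynomial.aeval _ _ * x = x * Polynomial.aeval _ _
          rw [Polynomial.aeval_monomial]
          exact ((Algebra.commute_algebraMap_left a x).mul_left ((hcen x).pow_left n)).eq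
    have : IsScalarTower K (Polynomial K) (UniversalEnvelopingAlgebra K (Virasoro K)) :=
      IsScalarTower.of_algebraMap_eq fun a => (Polynomial.aeval_C _ a).symm
    have hγ : AlgHom.id K _ (ι K (Virasoro.c K)) =
        algebraMap (Polynomial K) _ Polynomial.X := (Polynomial.aeval_X _).symm
    obtain ⟨θ, hθ⟩ := h.exists_hasDerivatives Function.surjective_id hγ (hker Polynomial.X)
      (one_smul K _) Polynomial.adjoin_X
    exact (h.isWittLike Function.surjective_id hγ).isHopfianRing hθ
      (transcendental_iff_injective.1 ht)

end Main

end

theorem mainTheorem7 (K : Type*) [Field K] [CharZero K] :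
    (IsBassianRing (UniversalEnvelopingAlgebra K (wittPos K)) ∧
      IsHopfianRing (UniversalEnvelopingAlgebra K (wittPos K))) ∧
    (IsBassianRing (UniversalEnvelopingAlgebra K (Witt K)) ∧
      IsHopfianRing (UniversalEnvelopingAlgebra K (Witt K))) ∧
    (IsBassianRing (UniversalEnvelopingAlgebra K (cartanW1 K)) ∧
      IsHopfianRing (UniversalEnvelopingAlgebra K (cartanW1 K))) ∧
    (∀ κ : K, IsBassianRing (Virasoro.CentralQuotient K κ) ∧
      IsHopfianRing (Virasoro.CentralQuotient K κ)) ∧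
    IsHopfianRing (UniversalEnvelopingAlgebra K (Virasoro K)) :=
  ⟨⟨isBassianRing_wittPos K, (isBassianRing_wittPos K).isHopfianRing⟩,
    ⟨isBassianRing_witt K, (isBassianRing_witt K).isHopfianRing⟩,
    ⟨isBassianRing_cartanW1 K, (isBassianRing_cartanW1 K).isHopfianRing⟩,
    fun κ => ⟨isBassianRing_centralQuotient K κ, (isBassianRing_centralQuotient K κ).isHopfianRing⟩,
    isHopfianRing_virasoro K⟩
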